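/- For $d,n\in\mathbb N$ and reals $V$ and $\tau>0$, let $\mathcal G(d,n,V,\tau)$ be the class of non-empty closed subsets $M\subset\mathbb R^n$ that are embedded $d$-dimensional $C^{2,1}$-smooth submanifolds without boundary (that is, $C^2$ with locally Lipschitz second derivatives), such that (i) $M\subseteq\partial K\subseteq B$, where $K=\operatorname{conv}(M)$ is the convex hull of $M$ and $B$ is the closed unit ball of $\mathbb R^n$ centered at $0$; (ii) the $d$-dimensional Hausdorff measure of $M$ (normalized to agree with Lebesgue measure on $\mathbb R^d$) is at most $V$; (iii) the reach of $M$ is at least $\tau$, where the reach is the supremum in $[0,\infty]$ of all $r\ge 0$ such that every $x\in\mathbb R^n$ with $\operatorname{dist}(x,M)\le r$ has a unique nearest point in $M$. A set $M\subset\mathbb R^n$ is called $R$-exposed if for every $p\in M$ there is a closed ball of radius $R$ that contains $M$ and has $p$ on its boundary. Let $\omega_d$ be the volume of the unit ball of $\mathbb R^d$, and let $d_H$ denote the Hausdorff distance. Lemma. There are absolute constants $c,C>0$ such that the following holds for all $d,n\in\mathbb N$, all reals $V$ and $\tau>0$, and all $0<\varepsilon<c$. Let $M\in\mathcal G(d,n,V,\tau)$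 and suppose that $$ n>\frac{CV}{\omega_d}\left(\min\left(\frac{\tau}{2d},\frac{\varepsilon\tau}{2}\right)\right)^{-d} $$ (for $d=0$ the power is understood to be $1$). Then there is a manifold $M_1\in\mathcal G(d,n,V,\tau(1-C\varepsilon))$, where in particular $\tau(1-C\varepsilon)>0$, such that $d_H(M,M_1)<\varepsilon\tau$ and $M_1$ is $R$-exposed for $R=(\varepsilon\tau)^{-1}$. -/

import Mathlib

open MeasureTheory

/-- `f` is of class `C^{2,1}` on the open set `W`: it is twice continuously differentiable there,
with locally Lipschitz second derivative. -/
def IsC21On {E F : Type*} [NormedAddCommGroup E] [NormedSpace ℝ E]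
    [NormedAddCommGroup F] [NormedSpace ℝ F] (f : E → F) (W : Set E) : Prop :=
  ContDiffOn ℝ 2 f W ∧ LocallyLipschitzOn W (iteratedFDeriv ℝ 2 f)

/-- `M` is an embedded `d`-dimensional `C^{2,1}` submanifold (without boundary) of `ℝⁿ`: every point
of `M` has an open neighbourhood `U` such that `M ∩ U` is the image of an open subset of `ℝᵈ` under
a `C^{2,1}` immersion which is a homeomorphism onto its image. -/
def IsC21Submanifold {n : ℕ} (d : ℕ) (M : Set (EuclideanSpace ℝ (Fin n))) : Prop :=
  ∀ p ∈ M, ∃ U : Set (EuclideanSpace ℝ (Fin n)), IsOpen U ∧ p ∈ U ∧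
    ∃ (W : Set (EuclideanSpace ℝ (Fin d)))
      (φ : EuclideanSpace ℝ (Fin d) → EuclideanSpace ℝ (Fin n)),
      IsOpen W ∧ IsC21On φ W ∧ (∀ x ∈ W, Function.Injective (fderiv ℝ φ x)) ∧
        Topology.IsEmbedding (W.domRestrict φ) ∧ φ '' W = M ∩ U

/-- The reach of `A ⊆ ℝⁿ`: the supremum (possibly `∞`) of all `r ≥ 0` such that every point at
distance at most `r` from `A` has a unique nearest point in `A`. -/
noncomputable def reach {n : ℕ} (A : Set (EuclideanSpace ℝ (Fin n))) : ENNReal :=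
  ⨆ (r : NNReal) (_ : ∀ x, Metric.infDist x A ≤ r → ∃! y, y ∈ A ∧ dist x y = Metric.infDist x A),
    (r : ENNReal)

/-- The class `𝒢(d, n, V, τ)`. The `d`-dimensional volume is the `d`-dimensional Hausdorff measure
in its standard normalization, which agrees with Lebesgue measure on `ℝᵈ`. -/
structure ManifoldClass (d n : ℕ) (V τ : ℝ) (M : Set (EuclideanSpace ℝ (Fin n))) : Prop where
  tau_pos : 0 < τ
  nonempty : M.Nonempty
  isClosed : IsClosed M
  submanifold : IsC21Submanifold d M
  subset_frontier : M ⊆ frontier (convexHull ℝ M)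
  frontier_subset : frontier (convexHull ℝ M) ⊆ Metric.closedBall 0 1
  volume_le : Measure.euclideanHausdorffMeasure d M ≤ ENNReal.ofReal V
  reach_ge : ENNReal.ofReal τ ≤ reach M

/-- `M` is `R`-exposed: for every `p ∈ M` there is a closed ball of radius `R` that contains `M`
and has `p` on its boundary. -/
def IsBallExposed {n : ℕ} (R : ℝ) (M : Set (EuclideanSpace ℝ (Fin n))) : Prop :=
  ∀ p ∈ M, ∃ z, M ⊆ Metric.closedBall z R ∧ p ∈ frontier (Metric.closedBall z R)

/-- The volume `ω_d` of the unit ball of `ℝᵈ`. -/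
noncomputable def unitBallVolume (d : ℕ) : ℝ :=
  volume.real (Metric.ball (0 : EuclideanSpace ℝ (Fin d)) 1)

open Set Filter Topology Metric
open scoped RealInnerProductSpace

/-! High dimension leaves room for a direction in which `M` is almost flat. Take a maximal
`2r`-separated subset of `M`, with `2r ≤ ετ`. Each ball of radius `r` about one of its points
carries a definite amount of volume of `M`, so the bound `V` forces fewer than `n` points, and some
unit vector `v` is orthogonal to all of them. Then `|⟪v, x⟫| ≤ ετ` on `M`, and positive reach turns
this small height into a small slope: secants of `M` have slope `O(√ε)` in the direction `v`
(`HasTangentField.abs_inner_sub_le`).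

Project `M` along `v`, lift the projection to the paraboloid of curvature `δ = 6ετ/5` with axis `v`,
and shrink by `s = 1/(1+δ²)`. This map `liftMap` is 1-Lipschitz on the unit ball, so neither the
volume bound nor containment in the ball is lost, and it moves points of `M` by less than `ετ`. Its
image lies on a strictly convex paraboloid and is therefore exposed by balls of radius `1/(ετ)`
(`isBallExposed_image_liftMap`), which also puts it on the boundary of its convex hull.

Reach is handled through Federer's criterion: reach at least `τ` amounts to `|⟪ν, q - p⟫| ≤ ‖ν‖‖q -
p‖²/(2τ)` for normals `ν` at `p`. One direction is `abs_inner_le_of_forall_hasUniqueProj`, the other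
`HasUniqueProj.of_inner_le`. The lift contracts secants by a factor `1 - O(ε)` at worst and adds
curvature of order `δ`, so the inequality survives with `τ(1 - Cε)`
(`HasTangentField.inner_liftMap_le`). The slope enters squared, which is why `√ε` suffices. -/

/-! ### `C^{2,1}` regularity under composition -/

theorem ContDiffOn.locallyLipschitzOn_of_isOpen {E F : Type*}
    [NormedAddCommGroup E] [NormedSpace ℝ E] [NormedAddCommGroup F] [NormedSpace ℝ F]
    {f : E → F} {W : Set E} (hW : IsOpen W) (hf : ContDiffOn ℝ 1 f W) :
    LocallyLipschitzOn W f := by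
  intro x hx
  obtain ⟨K, t, ht, hK⟩ := (hf.contDiffAt (hW.mem_nhds hx)).exists_lipschitzOnWith
  exact ⟨K, t, mem_nhdsWithin_of_mem_nhds ht, hK⟩

theorem LocallyLipschitzOn.add_fun {E F : Type*} [PseudoMetricSpace E] [NormedAddCommGroup F]
    {f g : E → F} {W : Set E} (hf : LocallyLipschitzOn W f) (hg : LocallyLipschitzOn W g) :
    LocallyLipschitzOn W (fun x => f x + g x) := by
  intro x hx
  obtain ⟨K, t, ht, hK⟩ := hf hx
  obtain ⟨K', t', ht', hK'⟩ := hg hx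
  exact ⟨K + K', t ∩ t', inter_mem ht ht',
    (hK.mono inter_subset_left).add (hK'.mono inter_subset_right)⟩

theorem LocallyLipschitzOn.congr_fun {E F : Type*} [PseudoMetricSpace E] [PseudoMetricSpace F]
    {f g : E → F} {W : Set E} (hf : LocallyLipschitzOn W f) (h : EqOn f g W) :
    LocallyLipschitzOn W g := by
  intro x hx
  obtain ⟨K, t, ht, hK⟩ := hf hx
  refine ⟨K, t ∩ W, inter_mem ht self_mem_nhdsWithin, fun y hy z hz => ?_⟩
  rw [← h hy.2, ← h hz.2]
  exact hK hy.1 hz.1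

theorem LocallyLipschitz.comp_locallyLipschitzOn {E F G : Type*} [PseudoMetricSpace E]
    [PseudoMetricSpace F] [PseudoMetricSpace G] {g : F → G} {f : E → F} {W : Set E}
    (hg : LocallyLipschitz g) (hf : LocallyLipschitzOn W f) :
    LocallyLipschitzOn W (fun x => g (f x)) := by
  intro x hx
  obtain ⟨K, t, ht, hK⟩ := hf hx
  obtain ⟨K', t', ht', hK'⟩ := hg (f x)
  have hc : ContinuousWithinAt f W x := hf.continuousOn x hx
  exact ⟨K' * K, t ∩ f ⁻¹' t', inter_mem ht (hc ht'),
    hK'.comp (hK.mono inter_subset_left) fun y hy => hy.2⟩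

theorem LocallyLipschitzOn.clm_bilinear {E F G H : Type*} [PseudoMetricSpace E]
    [NormedAddCommGroup F] [NormedSpace ℝ F] [NormedAddCommGroup G] [NormedSpace ℝ G]
    [NormedAddCommGroup H] [NormedSpace ℝ H] (B : F →L[ℝ] G →L[ℝ] H)
    {f : E → F} {g : E → G} {W : Set E} (hf : LocallyLipschitzOn W f)
    (hg : LocallyLipschitzOn W g) : LocallyLipschitzOn W (fun x => B (f x) (g x)) := by
  have hB : LocallyLipschitz (fun p : F × G => B p.1 p.2) :=
    (B.isBoundedBilinearMap.contDiff (n := 1)).locallyLipschitz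
  refine hB.comp_locallyLipschitzOn (f := fun x => (f x, g x)) ?_
  intro x hx
  obtain ⟨K, t, ht, hK⟩ := hf hx
  obtain ⟨K', t', ht', hK'⟩ := hg hx
  exact ⟨max K K', t ∩ t', inter_mem ht ht',
    (hK.mono inter_subset_left).prodMk (hK'.mono inter_subset_right)⟩

theorem locallyLipschitzOn_iteratedFDeriv_two_iff {E F : Type*}
    [NormedAddCommGroup E] [NormedSpace ℝ E] [NormedAddCommGroup F] [NormedSpace ℝ F]
    {f : E → F} {W : Set E} :
    LocallyLipschitzOn W (iteratedFDeriv ℝ 2 f) ↔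
      LocallyLipschitzOn W (fderiv ℝ (fderiv ℝ f)) := by
  have h1 : ∀ x, iteratedFDeriv ℝ 2 f x =
      (continuousMultilinearCurryRightEquiv' ℝ 1 E F).symm
        ((continuousMultilinearCurryRightEquiv' ℝ 0 E (E →L[ℝ] F)).symm
          ((continuousMultilinearCurryFin0 ℝ E (E →L[ℝ] E →L[ℝ] F)).symm
            (fderiv ℝ (fderiv ℝ f) x))) := by
    intro x
    rw [iteratedFDeriv_succ_eq_comp_right, Function.comp_apply,
      iteratedFDeriv_succ_eq_comp_right, Function.comp_apply, iteratedFDeriv_zero_eq_comp]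
    rfl
  have h2 : ∀ x y, edist (iteratedFDeriv ℝ 2 f x) (iteratedFDeriv ℝ 2 f y) =
      edist (fderiv ℝ (fderiv ℝ f) x) (fderiv ℝ (fderiv ℝ f) y) := by
    intro x y
    rw [h1, h1, LinearIsometryEquiv.edist_map, LinearIsometryEquiv.edist_map,
      LinearIsometryEquiv.edist_map]
  simp only [LocallyLipschitzOn, LipschitzOnWith, h2]

/-- By the chain rule the second derivative is a sum of bilinear expressions in `D²φ`, `Dφ` and the
derivatives of `Φ` along `φ`, each of them locally Lipschitz. -/
theorem IsC21On.contDiff_comp {E F G : Type*}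
    [NormedAddCommGroup E] [NormedSpace ℝ E] [NormedAddCommGroup F] [NormedSpace ℝ F]
    [NormedAddCommGroup G] [NormedSpace ℝ G]
    {φ : E → F} {W : Set E} {Φ : F → G} (hW : IsOpen W) (hφ : IsC21On φ W)
    (hΦ : ContDiff ℝ 3 Φ) : IsC21On (fun x => Φ (φ x)) W := by
  obtain ⟨h2, hL⟩ := hφ
  refine ⟨(hΦ.of_le (by norm_num)).comp_contDiffOn h2, ?_⟩
  rw [locallyLipschitzOn_iteratedFDeriv_two_iff] at hL ⊢
  have hd : ∀ x ∈ W, HasFDerivAt φ (fderiv ℝ φ x) x := fun x hx =>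
    ((h2.differentiableOn (by norm_num)).differentiableAt (hW.mem_nhds hx)).hasFDerivAt
  have hdφ : ContDiffOn ℝ 1 (fderiv ℝ φ) W := h2.fderiv_of_isOpen hW (by norm_num)
  have hdd : ∀ x ∈ W, HasFDerivAt (fderiv ℝ φ) (fderiv ℝ (fderiv ℝ φ) x) x := fun x hx =>
    ((hdφ.differentiableOn (by norm_num)).differentiableAt (hW.mem_nhds hx)).hasFDerivAt
  have hΦ1 : ContDiff ℝ 2 (fderiv ℝ Φ) := hΦ.fderiv_right (by norm_num)
  have hΦ2 : ContDiff ℝ 1 (fderiv ℝ (fderiv ℝ Φ)) := hΦ1.fderiv_right (by norm_num)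
  have hf1 : ∀ x ∈ W, fderiv ℝ (fun x => Φ (φ x)) x =
      ContinuousLinearMap.compL ℝ E F G (fderiv ℝ Φ (φ x)) (fderiv ℝ φ x) := fun x hx =>
    (((hΦ.differentiable (by norm_num)) (φ x)).hasFDerivAt.comp x (hd x hx)).fderiv
  have hψ : ∀ x ∈ W, HasFDerivAt (fun x => fderiv ℝ Φ (φ x))
      (ContinuousLinearMap.compL ℝ E F (F →L[ℝ] G) (fderiv ℝ (fderiv ℝ Φ) (φ x))
        (fderiv ℝ φ x)) x := fun x hx =>
    ((hΦ1.differentiable (by norm_num)) (φ x)).hasFDerivAt.comp x (hd x hx)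
  have hf2 : ∀ x ∈ W, fderiv ℝ (fderiv ℝ (fun x => Φ (φ x))) x =
      (ContinuousLinearMap.compL ℝ E F G).precompR E (fderiv ℝ Φ (φ x)) (fderiv ℝ (fderiv ℝ φ) x) +
      (ContinuousLinearMap.compL ℝ E F G).precompL E
        (ContinuousLinearMap.compL ℝ E F (F →L[ℝ] G) (fderiv ℝ (fderiv ℝ Φ) (φ x))
        (fderiv ℝ φ x)) (fderiv ℝ φ x) := by
    intro x hx
    have := (ContinuousLinearMap.compL ℝ E F G).hasFDerivAt_of_bilinear (hψ x hx) (hdd x hx)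
    refine (this.congr_of_eventuallyEq ?_).fderiv
    filter_upwards [hW.mem_nhds hx] with y hy using hf1 y hy
  have lφ : LocallyLipschitzOn W φ := (h2.of_le (by norm_num)).locallyLipschitzOn_of_isOpen hW
  have ldφ : LocallyLipschitzOn W (fderiv ℝ φ) := hdφ.locallyLipschitzOn_of_isOpen hW
  have l1 := LocallyLipschitzOn.clm_bilinear (F := F →L[ℝ] G) (G := E →L[ℝ] E →L[ℝ] F)
    (H := E →L[ℝ] E →L[ℝ] G) ((ContinuousLinearMap.compL ℝ E F G).precompR E)
    ((hΦ1.of_le (by norm_num)).locallyLipschitz.comp_locallyLipschitzOn lφ) hL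
  have l2 := LocallyLipschitzOn.clm_bilinear (F := F →L[ℝ] F →L[ℝ] G) (G := E →L[ℝ] F)
    (H := E →L[ℝ] F →L[ℝ] G) (ContinuousLinearMap.compL ℝ E F (F →L[ℝ] G))
    (hΦ2.locallyLipschitz.comp_locallyLipschitzOn lφ) ldφ
  have l3 := LocallyLipschitzOn.clm_bilinear (F := E →L[ℝ] F →L[ℝ] G) (G := E →L[ℝ] F)
    (H := E →L[ℝ] E →L[ℝ] G) ((ContinuousLinearMap.compL ℝ E F G).precompL E)
    l2 ldφ
  exact (l1.add_fun l3).congr_fun fun x hx => (hf2 x hx).symm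

/-! ### Tangent spaces -/

/-- `T` is the tangent space at `p` of the `d`-dimensional submanifold `M`, read off from a
local `C²` parametrization. -/
def IsTangent {F : Type*} [NormedAddCommGroup F] [NormedSpace ℝ F] (d : ℕ) (M : Set F) (p : F)
    (T : Submodule ℝ F) : Prop :=
  ∃ (φ : EuclideanSpace ℝ (Fin d) → F) (x : EuclideanSpace ℝ (Fin d)),
    ContDiffAt ℝ 2 φ x ∧ Function.Injective (fderiv ℝ φ x) ∧ φ x = p ∧
      map φ (𝓝 x) = 𝓝[M] p ∧ (fderiv ℝ φ x).range = T

theorem IsC21Submanifold.exists_isTangent {d n : ℕ} {M : Set (EuclideanSpace ℝ (Fin n))}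
    (hM : IsC21Submanifold d M) {p : EuclideanSpace ℝ (Fin n)} (hp : p ∈ M) :
    ∃ T, IsTangent d M p T := by
  obtain ⟨U, hU, hpU, W, φ, hW, hφ, hinj, hemb, himg⟩ := hM p hp
  obtain ⟨x, hx, hxp⟩ : p ∈ φ '' W := himg ▸ ⟨hp, hpU⟩
  refine ⟨_, φ, x, hφ.1.contDiffAt (hW.mem_nhds hx), hinj x hx, hxp, ?_, rfl⟩
  have h := hemb.map_nhds_eq ⟨x, hx⟩
  have hr : range (W.domRestrict φ) = M ∩ U := by
    rw [← himg]; exact range_domRestrict φ W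
  rw [hr] at h
  have h2 : map φ (map Subtype.val (𝓝 (⟨x, hx⟩ : W))) = 𝓝[M ∩ U] p := by
    rw [Filter.map_map, ← hxp]; exact h
  rw [map_nhds_subtype_coe_eq_nhds hx (hW.mem_nhds hx)] at h2
  rw [h2, nhdsWithin_inter_of_mem' (mem_nhdsWithin_of_mem_nhds (hU.mem_nhds hpU))]

section

variable {F : Type*} [NormedAddCommGroup F] [InnerProductSpace ℝ F] {d : ℕ} {M : Set F} {p : F}
  {T : Submodule ℝ F}

theorem ContDiffAt.exists_norm_sub_sub_fderiv_le {E G : Type*} [NormedAddCommGroup E]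
    [NormedSpace ℝ E] [NormedAddCommGroup G] [NormedSpace ℝ G] {φ : E → G} {x : E}
    (h : ContDiffAt ℝ 2 φ x) :
    ∃ K : ℝ, 0 ≤ K ∧ ∀ᶠ y in 𝓝 x, ‖φ y - φ x - fderiv ℝ φ x (y - x)‖ ≤ K * ‖y - x‖ ^ 2 := by
  obtain ⟨K, t, ht, hK⟩ := (h.fderiv_right (m := 1) (by norm_num)).exists_lipschitzOnWith
  have hd : ∀ᶠ y in 𝓝 x, DifferentiableAt ℝ φ y :=
    (h.eventually (by norm_num)).mono fun y hy => hy.differentiableAt (by norm_num)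
  obtain ⟨r, hr, hball⟩ := Metric.eventually_nhds_iff_ball.1 (hd.and ht)
  refine ⟨K, K.2, ?_⟩
  filter_upwards [ball_mem_nhds x hr] with y hy
  have hsub : closedBall x ‖y - x‖ ⊆ ball x r :=
    closedBall_subset_ball (by rwa [← dist_eq_norm, ← mem_ball])
  have := (convex_closedBall x ‖y - x‖).norm_image_sub_le_of_norm_hasFDerivWithin_le'
    (f := φ) (f' := fderiv ℝ φ) (φ := fderiv ℝ φ x) (C := K * ‖y - x‖) (x := x) (y := y)
    (fun z hz => (hball z (hsub hz)).1.hasFDerivAt.hasFDerivWithinAt) ?_ ?_ ?_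
  · rwa [pow_two, ← mul_assoc]
  · intro z hz
    have := hK.dist_le_mul z (hball z (hsub hz)).2 x (hball x (mem_ball_self hr)).2
    rw [dist_eq_norm] at this
    exact this.trans (mul_le_mul_of_nonneg_left (mem_closedBall.1 hz) K.2)
  · simp
  · simp [dist_eq_norm]

/-- A normal vector annihilates the linear term of the Taylor expansion of a parametrization,
leaving only the quadratic remainder. -/
theorem IsTangent.exists_inner_le (h : IsTangent d M p T) :
    ∃ K : ℝ, 0 ≤ K ∧ ∀ᶠ q in 𝓝[M] p, ∀ ν ∈ Tᗮ, ⟪ν, q - p⟫ ≤ K * ‖ν‖ * ‖q - p‖ ^ 2 := by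
  obtain ⟨φ, x, h2, hinj, rfl, hmap, rfl⟩ := h
  obtain ⟨K, hK, hK'⟩ := h2.exists_norm_sub_sub_fderiv_le
  obtain ⟨c, hc, hA⟩ := (fderiv ℝ φ x).toLinearMap.exists_antilipschitzWith
    (LinearMap.ker_eq_bot.2 hinj)
  have hc' : (0 : ℝ) < c := hc
  have hA' : ∀ z, ‖z‖ ≤ c * ‖fderiv ℝ φ x z‖ := fun z => by
    have := hA.le_mul_dist z 0
    simpa using this
  refine ⟨K * (2 * c) ^ 2, by positivity, ?_⟩
  rw [← hmap, eventually_map]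
  -- This close to `x` the quadratic error is absorbed, so `φ` inherits the lower bound of its
  -- derivative up to a factor `2`.
  have hsmall : ∀ᶠ y in 𝓝 x, 2 * c * K * ‖y - x‖ < 1 := by
    have : Tendsto (fun y => 2 * c * K * ‖y - x‖) (𝓝 x) (𝓝 (2 * c * K * ‖x - x‖)) :=
      (by fun_prop : Continuous fun y => 2 * c * K * ‖y - x‖).tendsto x
    simp only [sub_self, norm_zero, mul_zero] at this
    exact this.eventually_lt_const one_pos
  filter_upwards [hK', hsmall] with y hy hs ν hν
  have h1 : ‖fderiv ℝ φ x (y - x)‖ ≤ ‖φ y - φ x‖ + K * ‖y - x‖ ^ 2 := by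
    have := norm_sub_norm_le (fderiv ℝ φ x (y - x)) (φ y - φ x)
    rw [norm_sub_rev (fderiv ℝ φ x (y - x)) (φ y - φ x)] at this
    linarith
  have h3 := hA' (y - x)
  have h4 : ‖y - x‖ ≤ 2 * c * ‖φ y - φ x‖ := by
    have e1 := mul_le_mul_of_nonneg_left h1 hc'.le
    have e2 : c * (K * ‖y - x‖ ^ 2) ≤ ‖y - x‖ / 2 := by
      have := mul_le_mul_of_nonneg_right hs.le (norm_nonneg (y - x))
      nlinarith
    nlinarith
  have h5 : ⟪ν, φ y - φ x⟫ = ⟪ν, φ y - φ x - fderiv ℝ φ x (y - x)⟫ := by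
    have h0 : ⟪ν, fderiv ℝ φ x (y - x)⟫ = 0 :=
      Submodule.inner_left_of_mem_orthogonal (LinearMap.mem_range_self _ (y - x)) hν
    rw [inner_sub_right ν (φ y - φ x), h0, sub_zero]
  rw [h5]
  refine (real_inner_le_norm _ _).trans ?_
  calc ‖ν‖ * ‖φ y - φ x - fderiv ℝ φ x (y - x)‖ ≤ ‖ν‖ * (K * (2 * c * ‖φ y - φ x‖) ^ 2) := by
        gcongr
        exact hy.trans (by gcongr)
    _ = _ := by ring

theorem IsTangent.fderiv_eq_zero_of_isLocalExtrOn (h : IsTangent d M p T) {g : F → ℝ}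
    {g' : F →L[ℝ] ℝ} (hg : HasFDerivAt g g' p) (hext : IsLocalExtrOn g M p) {u : F}
    (hu : u ∈ T) : g' u = 0 := by
  obtain ⟨φ, x, h2, hinj, rfl, hmap, rfl⟩ := h
  obtain ⟨ξ, rfl⟩ := hu
  have hφ : HasFDerivAt φ (fderiv ℝ φ x) x := (h2.differentiableAt (by norm_num)).hasFDerivAt
  have hl : IsLocalExtr (g ∘ φ) x :=
    IsExtrFilter.comp_tendsto (l' := 𝓝 x) (l := 𝓝[M] φ x) hext (by rw [← hmap]; exact tendsto_map)
  have := hl.hasFDerivAt_eq_zero (hg.comp x hφ)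
  simpa using congrArg (fun L => L ξ) this

theorem IsTangent.infDist_add_smul_le (h : IsTangent d M p T) {u : F} (hu : u ∈ T) {η : ℝ}
    (hη : 0 < η) : ∀ᶠ t in 𝓝[>] (0 : ℝ), infDist (p + t • u) M ≤ η * t := by
  obtain ⟨φ, x, h2, hinj, rfl, hmap, rfl⟩ := h
  obtain ⟨ξ, rfl⟩ := hu
  have hφ : HasFDerivAt φ (fderiv ℝ φ x) x := (h2.differentiableAt (by norm_num)).hasFDerivAt
  have hc : HasDerivAt (fun t : ℝ => φ (x + t • ξ)) (fderiv ℝ φ x ξ) 0 := by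
    have hl : HasDerivAt (fun t : ℝ => x + t • ξ) ξ 0 := by
      simpa using ((hasDerivAt_id (0 : ℝ)).smul_const ξ).const_add x
    exact HasFDerivAt.comp_hasDerivAt (f := fun t : ℝ => x + t • ξ) (0 : ℝ) (by simpa using hφ) hl
  have h1 := (hasDerivAt_iff_isLittleO_nhds_zero.1 hc).def hη
  have hmem : ∀ᶠ t in 𝓝 (0 : ℝ), φ (x + t • ξ) ∈ M := by
    have h3 : ∀ᶠ y in 𝓝 x, φ y ∈ M := by
      rw [← eventually_map (m := φ) (P := fun z => z ∈ M), hmap]; exact self_mem_nhdsWithin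
    have h4 : Tendsto (fun t : ℝ => x + t • ξ) (𝓝 0) (𝓝 x) := by
      have : Continuous (fun t : ℝ => x + t • ξ) := by fun_prop
      simpa using this.tendsto 0
    exact h4.eventually h3
  filter_upwards [nhdsWithin_le_nhds h1, nhdsWithin_le_nhds hmem, self_mem_nhdsWithin] with t a b c
  refine (infDist_le_dist_of_mem b).trans ?_
  rw [dist_eq_norm, norm_sub_rev]
  simp only [zero_add, zero_smul, add_zero, Real.norm_eq_abs, abs_of_pos (mem_Ioi.1 c)] at a
  rwa [← sub_sub]

theorem IsTangent.finrank_eq (h : IsTangent d M p T) : Module.finrank ℝ T = d := by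
  obtain ⟨φ, x, h2, hinj, rfl, hmap, rfl⟩ := h
  have := LinearMap.finrank_range_of_inj (f := (fderiv ℝ φ x).toLinearMap) hinj
  simpa using this

/-- Transversality makes the derivative of the projected parametrization injective, hence bijective
by dimension count; a strictly differentiable map with surjective derivative is locally open. -/
theorem IsTangent.map_orthogonalProjectionOnto [FiniteDimensional ℝ F] (h : IsTangent d M p T)
    {S : Submodule ℝ F} (hS : Module.finrank ℝ S = d) (hTS : T ⊓ Sᗮ = ⊥) :
    map S.orthogonalProjectionOnto (𝓝[M] p) = 𝓝 (S.orthogonalProjectionOnto p) := by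
  obtain ⟨φ, x, h2, hinj, rfl, hmap, rfl⟩ := h
  have hφ : HasStrictFDerivAt φ (fderiv ℝ φ x) x := h2.hasStrictFDerivAt (by norm_num)
  have hc : HasStrictFDerivAt (fun y => S.orthogonalProjectionOnto (φ y))
      (S.orthogonalProjectionOnto.comp (fderiv ℝ φ x)) x :=
    S.orthogonalProjectionOnto.hasStrictFDerivAt.comp x hφ
  rw [← hmap, Filter.map_map]
  refine hc.map_nhds_eq_of_surj (LinearMap.range_eq_top.2 ?_)
  have hfin : Module.finrank ℝ (EuclideanSpace ℝ (Fin d)) = Module.finrank ℝ S := by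
    rw [hS]; simp
  refine (LinearMap.injective_iff_surjective_of_finrank_eq_finrank hfin).1 ?_
  refine LinearMap.ker_eq_bot.1 ((Submodule.eq_bot_iff _).2 fun ξ hξ => ?_)
  have h0 : S.orthogonalProjectionOnto (fderiv ℝ φ x ξ) = 0 := hξ
  have h1 : fderiv ℝ φ x ξ ∈ Sᗮ := Submodule.orthogonalProjectionOnto_eq_zero_iff.1 h0
  have h3 : fderiv ℝ φ x ξ ∈ (⊥ : Submodule ℝ F) := hTS ▸ ⟨LinearMap.mem_range_self _ ξ, h1⟩
  exact hinj (by rw [(Submodule.mem_bot ℝ).1 h3, map_zero])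

end

/-! ### Reach and Federer's inequality -/

section

variable {F : Type*} [NormedAddCommGroup F] [InnerProductSpace ℝ F]

/-- Every point at distance at most `r` from `M` has a unique nearest point in `M`. -/
def HasUniqueProj {F : Type*} [PseudoMetricSpace F] (M : Set F) (r : ℝ) : Prop :=
  ∀ x, infDist x M ≤ r → ∃! y, y ∈ M ∧ dist x y = infDist x M

theorem exists_dist_lt_of_unique_nearest [FiniteDimensional ℝ F] {M : Set F} (hM : IsClosed M)
    {y b : F} (hu : ∀ q ∈ M, dist y q = infDist y M → q = b) {η : ℝ} (hη : 0 < η) :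
    ∃ δ > 0, ∀ q ∈ M, dist y q < infDist y M + δ → dist q b < η := by
  have : ProperSpace F := FiniteDimensional.proper ℝ F
  set K := M ∩ closedBall y (infDist y M + 1) ∩ {q | η ≤ dist q b} with hK
  have hKc : IsCompact K := by
    refine IsCompact.of_isClosed_subset (isCompact_closedBall y (infDist y M + 1)) ?_
      fun z hz => hz.1.2
    exact (hM.inter isClosed_closedBall).inter
      (isClosed_le continuous_const (continuous_id.dist continuous_const))
  rcases K.eq_empty_or_nonempty with he | hne
  · refine ⟨1, one_pos, fun q hq hd => ?_⟩
    by_contra! hc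
    have : q ∈ K := ⟨⟨hq, by rw [mem_closedBall, dist_comm]; exact hd.le⟩, hc⟩
    rw [he] at this
    exact this
  · obtain ⟨m, hm, hmin⟩ := hKc.exists_isMinOn hne
      (f := fun q => dist y q) (continuous_const.dist continuous_id).continuousOn
    have hlt : infDist y M < dist y m := by
      refine lt_of_le_of_ne (infDist_le_dist_of_mem hm.1.1) fun he => ?_
      have := hu m hm.1.1 he.symm
      have h2 : η ≤ dist m b := hm.2
      rw [this, dist_self] at h2
      linarith
    refine ⟨min 1 (dist y m - infDist y M), lt_min one_pos (by linarith), fun q hq hd => ?_⟩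
    by_contra! hc
    have h1 := min_le_left 1 (dist y m - infDist y M)
    have h2 := min_le_right 1 (dist y m - infDist y M)
    have : q ∈ K := ⟨⟨hq, by rw [mem_closedBall, dist_comm]; linarith⟩, hc⟩
    have h3 : dist y m ≤ dist y q := hmin this
    linarith

/-- Move straight away from the unique nearest point `b`. Nearest points of nearby points are close
to `b`, so the distance to every competitor grows at nearly unit rate. -/
theorem exists_infDist_slope_gt [FiniteDimensional ℝ F] {M : Set F} (hM : IsClosed M)
    {y : F} (hy : ∃! b, b ∈ M ∧ dist y b = infDist y M) (hpos : 0 < infDist y M) {c : ℝ}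
    (hc0 : 0 ≤ c) (hc1 : c < 1) :
    ∃ u : F, ‖u‖ = 1 ∧ ∀ᶠ h in 𝓝[>] (0 : ℝ), infDist y M + c * h < infDist (y + h • u) M := by
  have : ProperSpace F := FiniteDimensional.proper ℝ F
  obtain ⟨b, ⟨hb, hyb⟩, hu⟩ := hy
  set ρ := infDist y M with hρ
  have hnb : ‖y - b‖ = ρ := by rw [← dist_eq_norm, hyb]
  obtain ⟨δ, hδ, hδ'⟩ := exists_dist_lt_of_unique_nearest hM (fun q hq h => hu q ⟨hq, h⟩)
    (η := (1 - c) * ρ / 2) (by have := sub_pos.2 hc1; positivity)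
  have hu1 : ‖ρ⁻¹ • (y - b)‖ = 1 := by
    rw [norm_smul, hnb, Real.norm_eq_abs, abs_of_pos (inv_pos.2 hpos), inv_mul_cancel₀ hpos.ne']
  set u := ρ⁻¹ • (y - b) with hudef
  have huy : ⟪u, y - b⟫ = ρ := by
    rw [hudef, real_inner_smul_left, real_inner_self_eq_norm_sq, hnb]; field_simp
  refine ⟨u, hu1, ?_⟩
  filter_upwards [Ioo_mem_nhdsGT (show (0 : ℝ) < δ / 2 by linarith)] with h hh
  have h0 : 0 < h := hh.1
  obtain ⟨q, hq, hqd⟩ := hM.exists_infDist_eq_dist ⟨b, hb⟩ (y + h • u)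
  have hnu : ‖h • u‖ = h := by rw [norm_smul, hu1, mul_one, Real.norm_eq_abs, abs_of_pos h0]
  have e1 : dist (y + h • u) y = h := by rw [dist_eq_norm, add_sub_cancel_left, hnu]
  have e2 : dist (y + h • u) q ≤ ρ + h := by
    rw [← hqd]
    refine (infDist_le_dist_of_mem hb).trans ((dist_triangle _ y _).trans ?_)
    rw [e1, hyb]; linarith
  have e3 : dist y q < ρ + δ := by
    have := dist_triangle y (y + h • u) q
    rw [dist_comm y (y + h • u), e1] at this
    linarith [hh.2]
  have e4 := hδ' q hq e3
  have e5 : ρ - (1 - c) * ρ / 2 ≤ ⟪u, y - q⟫ := by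
    have : ⟪u, y - q⟫ = ρ - ⟪u, q - b⟫ := by
      rw [← huy, ← inner_sub_right]; congr 1; abel
    rw [this]
    have h6 := real_inner_le_norm u (q - b)
    rw [hu1, one_mul, ← dist_eq_norm] at h6
    linarith
  have e6 : ρ ≤ ‖y - q‖ := by rw [← dist_eq_norm]; exact infDist_le_dist_of_mem hq
  have e7 : ‖y + h • u - q‖ ^ 2 = ‖y - q‖ ^ 2 + 2 * h * ⟪u, y - q⟫ + h ^ 2 := by
    have : y + h • u - q = (y - q) + h • u := by abel
    rw [this, norm_add_sq_real, hnu, real_inner_smul_right, real_inner_comm]; ring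
  rw [hqd, dist_eq_norm]
  refine lt_of_pow_lt_pow_left₀ 2 (norm_nonneg _) ?_
  rw [e7]
  have e8 := mul_le_mul_of_nonneg_left e5 h0.le
  have e9 : 0 < (1 - c) * (ρ * h) := mul_pos (by linarith) (mul_pos hpos h0)
  have e10 : c ^ 2 * h ^ 2 ≤ 1 * h ^ 2 := by gcongr; nlinarith
  nlinarith

/-- A maximizer of `infDist z M - c * dist z x` over the ball cannot be interior, since the distance
can still be increased there at a rate above `c`. -/
theorem HasUniqueProj.exists_infDist_ge [FiniteDimensional ℝ F] {M : Set F} (hM : IsClosed M)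
    {r : ℝ} (hr : HasUniqueProj M r) {x : F} (hs : 0 < infDist x M) {t : ℝ} (ht : 0 ≤ t)
    (hst : infDist x M + t ≤ r) {c : ℝ} (hc0 : 0 ≤ c) (hc1 : c < 1) :
    ∃ y ∈ closedBall x t, infDist x M + c * t ≤ infDist y M := by
  have : ProperSpace F := FiniteDimensional.proper ℝ F
  obtain ⟨y, hy, hmax⟩ := (isCompact_closedBall x t).exists_isMaxOn ⟨x, mem_closedBall_self ht⟩
    (f := fun z => infDist z M - c * dist z x)
    ((continuous_infDist_pt M).sub (continuous_const.mul
      (continuous_id.dist continuous_const))).continuousOn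
  have hyx : infDist x M ≤ infDist y M - c * dist y x := by
    simpa using hmax (mem_closedBall_self ht)
  have hyt : dist y x ≤ t := hy
  rcases hyt.eq_or_lt with he | hlt
  · exact ⟨y, hy, by rw [he] at hyx; linarith⟩
  exfalso
  have hpos : 0 < infDist y M := by
    have := mul_nonneg hc0 (dist_nonneg (x := y) (y := x)); linarith
  have hyr : infDist y M ≤ r := by
    have := infDist_le_infDist_add_dist (s := M) (x := y) (y := x); linarith
  obtain ⟨u, hu, hev⟩ := exists_infDist_slope_gt hM (hr y hyr) hpos hc0 hc1
  obtain ⟨h, h1, h2⟩ := (hev.and (Ioo_mem_nhdsGT (show (0 : ℝ) < t - dist y x by linarith))).exists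
  have hd : dist (y + h • u) x ≤ dist y x + h := by
    have := dist_triangle (y + h • u) y x
    have e : dist (y + h • u) y = h := by
      rw [dist_eq_norm, add_sub_cancel_left, norm_smul, hu, mul_one, Real.norm_eq_abs,
        abs_of_pos h2.1]
    linarith
  have h3 : infDist (y + h • u) M - c * dist (y + h • u) x ≤ infDist y M - c * dist y x :=
    hmax (mem_closedBall.2 (by linarith [h2.2]))
  have := mul_le_mul_of_nonneg_left hd hc0
  linarith

/-- Letting `c → 1`, some point of the ball of radius `t` has distance at least `s + t` from `M`.
Equality in the triangle inequality through `x` puts that point on the ray from `a`. -/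
theorem HasUniqueProj.infDist_ray [FiniteDimensional ℝ F] {M : Set F} (hM : IsClosed M)
    {r : ℝ} (hr : HasUniqueProj M r) {x a : F} (ha : a ∈ M) {s t : ℝ} (hs : 0 < s)
    (hxs : infDist x M = s) (hxa : ‖x - a‖ = s) (ht : 0 ≤ t) (hst : s + t ≤ r) :
    infDist (x + (t / s) • (x - a)) M = s + t := by
  have : ProperSpace F := FiniteDimensional.proper ℝ F
  obtain ⟨y, hy, hmax⟩ := (isCompact_closedBall x t).exists_isMaxOn ⟨x, mem_closedBall_self ht⟩
    (f := fun z => infDist z M) (continuous_infDist_pt M).continuousOn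
  have hge : s + t ≤ infDist y M := by
    have h1 : ∀ c, 0 ≤ c → c < 1 → s + c * t ≤ infDist y M := by
      intro c h0 h1
      obtain ⟨z, hz, hz'⟩ := hr.exists_infDist_ge hM (by rwa [hxs]) ht (by rwa [hxs]) h0 h1
      rw [hxs] at hz'
      exact hz'.trans (hmax hz)
    have hcl : (1 : ℝ) ∈ closure (Ico (0 : ℝ) 1) := by
      rw [closure_Ico (by norm_num)]; simp
    have := closure_minimal (s := Ico (0 : ℝ) 1) (t := {c | s + c * t ≤ infDist y M})
      (fun c hc => h1 c hc.1 hc.2) (isClosed_le (by fun_prop) continuous_const) hcl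
    simpa using this
  have hyx : ‖y - x‖ ≤ t := by rw [← dist_eq_norm]; exact hy
  have hya : s + t ≤ ‖(y - x) + (x - a)‖ := by
    rw [sub_add_sub_cancel, ← dist_eq_norm]; exact hge.trans (infDist_le_dist_of_mem ha)
  have hsq := norm_add_sq_real (y - x) (x - a)
  have h1 : (s + t) ^ 2 ≤ ‖(y - x) + (x - a)‖ ^ 2 := by gcongr
  have h2 : ‖y - x‖ ^ 2 ≤ t ^ 2 := by gcongr
  have h3 : s * t ≤ ⟪y - x, x - a⟫ := by rw [hsq, hxa] at h1; nlinarith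
  have h4 : ‖(y - x) - (t / s) • (x - a)‖ ^ 2 ≤ 0 := by
    rw [norm_sub_sq_real, real_inner_smul_right, norm_smul, hxa, Real.norm_eq_abs,
      abs_of_nonneg (by positivity), div_mul_cancel₀ _ hs.ne']
    have : t / s * (s * t) ≤ t / s * ⟪y - x, x - a⟫ := by gcongr
    have e : t / s * (s * t) = t ^ 2 := by field_simp
    rw [e] at this
    linarith
  have h5 : (y - x) - (t / s) • (x - a) = 0 := by
    rw [← norm_eq_zero]; exact pow_eq_zero_iff (two_ne_zero) |>.1 (le_antisymm h4 (by positivity))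
  have h6 : x + (t / s) • (x - a) = y := by rw [← sub_eq_zero.1 h5]; abel
  rw [h6]
  refine le_antisymm ?_ hge
  have := infDist_le_infDist_add_dist (s := M) (x := y) (y := x)
  rw [dist_eq_norm] at this
  linarith

variable {d : ℕ} {M : Set F} {p : F} {T : Submodule ℝ F}

theorem IsTangent.exists_inner_le_forall (h : IsTangent d M p T) {ν : F} (hν : ν ∈ Tᗮ) :
    ∃ K : ℝ, 0 < K ∧ ∀ q ∈ M, ⟪ν, q - p⟫ ≤ K * ‖q - p‖ ^ 2 := by
  obtain ⟨K, hK, hev⟩ := h.exists_inner_le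
  obtain ⟨η, hη, hball⟩ := Metric.mem_nhdsWithin_iff.1 hev
  refine ⟨K * ‖ν‖ + ‖ν‖ / η + 1, by positivity, fun q hq => ?_⟩
  rcases lt_or_ge (dist q p) η with hlt | hge
  · have h1 : ⟪ν, q - p⟫ ≤ K * ‖ν‖ * ‖q - p‖ ^ 2 := hball ⟨hlt, hq⟩ ν hν
    refine h1.trans ?_
    gcongr
    have : 0 ≤ ‖ν‖ / η := by positivity
    linarith
  · rw [dist_eq_norm] at hge
    calc ⟪ν, q - p⟫ ≤ ‖ν‖ * ‖q - p‖ := real_inner_le_norm _ _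
      _ = ‖ν‖ / η * (η * ‖q - p‖) := by field_simp
      _ ≤ ‖ν‖ / η * (‖q - p‖ * ‖q - p‖) := by gcongr
      _ = ‖ν‖ / η * ‖q - p‖ ^ 2 := by ring
      _ ≤ _ := by
        gcongr
        have : 0 ≤ K * ‖ν‖ := by positivity
        linarith

/-- The point `p` is nearest to `p + s • ν` for small `s`; the ray lemma extends this to `s = r`, so
the ball of radius `r` tangent to `M` at `p` has no point of `M` inside. -/
theorem HasUniqueProj.inner_le [FiniteDimensional ℝ F] (hM : IsClosed M) {r : ℝ} (hr0 : 0 < r)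
    (hr : HasUniqueProj M r) (hT : IsTangent d M p T) (hp : p ∈ M) {ν : F} (hν : ν ∈ Tᗮ)
    (hν1 : ‖ν‖ = 1) {q : F} (hq : q ∈ M) : 2 * r * ⟪ν, q - p⟫ ≤ ‖q - p‖ ^ 2 := by
  obtain ⟨K, hK, hle⟩ := hT.exists_inner_le_forall hν
  -- The condition `2Ks ≤ 1` lets the quadratic bound keep all of `M` at distance at least `s` from
  -- `p + s • ν`.
  set s := min (1 / (2 * K)) r with hs
  have hs0 : 0 < s := lt_min (by positivity) hr0
  have hsK : 2 * K * s ≤ 1 := by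
    have := min_le_left (1 / (2 * K)) r
    rw [le_div_iff₀ (by positivity)] at this
    linarith
  have hsr : s ≤ r := min_le_right _ _
  have hsq : ∀ (t : ℝ) (z : F), ‖p + t • ν - z‖ ^ 2 = t ^ 2 - 2 * t * ⟪ν, z - p⟫ + ‖z - p‖ ^ 2 := by
    intro t z
    have : p + t • ν - z = t • ν - (z - p) := by abel
    rw [this, norm_sub_sq_real, real_inner_smul_left, norm_smul, hν1, Real.norm_eq_abs, mul_one,
      sq_abs]; ring
  have hxp : ‖p + s • ν - p‖ = s := by
    rw [add_sub_cancel_left, norm_smul, hν1, mul_one, Real.norm_eq_abs, abs_of_pos hs0]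
  have hx : infDist (p + s • ν) M = s := by
    refine le_antisymm ?_ ((le_infDist ⟨p, hp⟩).2 fun z hz => ?_)
    · have := infDist_le_dist_of_mem (x := p + s • ν) hp
      rwa [dist_eq_norm, hxp] at this
    · rw [dist_eq_norm]
      refine le_of_sq_le_sq ?_ (norm_nonneg _)
      rw [hsq]
      have h1 := mul_le_mul_of_nonneg_left (hle z hz) hs0.le
      have h2 := mul_le_mul_of_nonneg_right hsK (sq_nonneg ‖z - p‖)
      nlinarith
  have hray := hr.infDist_ray hM hp hs0 hx hxp (sub_nonneg.2 hsr) (by linarith)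
  have he : p + s • ν + ((r - s) / s) • (p + s • ν - p) = p + r • ν := by
    rw [add_sub_cancel_left, smul_smul, div_mul_cancel₀ _ hs0.ne', add_assoc, ← add_smul]
    congr 2; ring
  rw [he] at hray
  have h1 : r ≤ ‖p + r • ν - q‖ := by
    have := infDist_le_dist_of_mem (x := p + r • ν) hq
    rw [dist_eq_norm] at this
    linarith
  have h2 : r ^ 2 ≤ ‖p + r • ν - q‖ ^ 2 := by gcongr
  rw [hsq] at h2
  linarith

theorem abs_inner_le_of_forall_hasUniqueProj [FiniteDimensional ℝ F] (hM : IsClosed M) {τ : ℝ}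
    (hτ : 0 < τ) (hr : ∀ r, 0 < r → r < τ → HasUniqueProj M r) (hT : IsTangent d M p T)
    (hp : p ∈ M) {ν : F} (hν : ν ∈ Tᗮ) {q : F} (hq : q ∈ M) :
    |⟪ν, q - p⟫| ≤ ‖ν‖ * ‖q - p‖ ^ 2 / (2 * τ) := by
  have key : ∀ μ ∈ Tᗮ, ‖μ‖ = 1 → 2 * τ * ⟪μ, q - p⟫ ≤ ‖q - p‖ ^ 2 := by
    intro μ hμ hμ1
    have hcl : τ ∈ closure (Ioo 0 τ) := by rw [closure_Ioo hτ.ne]; exact ⟨hτ.le, le_rfl⟩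
    exact closure_minimal (s := Ioo 0 τ) (t := {r | 2 * r * ⟪μ, q - p⟫ ≤ ‖q - p‖ ^ 2})
      (fun r h => (hr r h.1 h.2).inner_le hM h.1 hT hp hμ hμ1 hq)
      (isClosed_le (by fun_prop) continuous_const) hcl
  have key2 : ∀ μ ∈ Tᗮ, ⟪μ, q - p⟫ ≤ ‖μ‖ * ‖q - p‖ ^ 2 / (2 * τ) := by
    intro μ hμ
    rcases eq_or_ne μ 0 with rfl | h0
    · simp
    have hn : 0 < ‖μ‖ := norm_pos_iff.2 h0
    have := key (‖μ‖⁻¹ • μ) (Submodule.smul_mem _ _ hμ) 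
      (by rw [norm_smul, norm_inv, norm_norm, inv_mul_cancel₀ hn.ne'])
    rw [real_inner_smul_left] at this
    rw [le_div_iff₀ (by positivity)]
    have h2 := mul_le_mul_of_nonneg_left this hn.le
    have e : ‖μ‖ * (2 * τ * (‖μ‖⁻¹ * ⟪μ, q - p⟫)) = ⟪μ, q - p⟫ * (2 * τ) := by field_simp
    linarith
  refine abs_le'.2 ⟨key2 ν hν, ?_⟩
  have := key2 (-ν) (Submodule.neg_mem _ hν)
  rwa [inner_neg_left, norm_neg] at this

end

theorem hasUniqueProj_of_lt_reach {n : ℕ} {M : Set (EuclideanSpace ℝ (Fin n))} {τ : ℝ}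
    (h : ENNReal.ofReal τ ≤ reach M) {r : ℝ} (hr0 : 0 < r) (hr : r < τ) : HasUniqueProj M r := by
  have h1 : ENNReal.ofReal r < reach M :=
    ((ENNReal.ofReal_lt_ofReal_iff (hr0.trans hr)).2 hr).trans_le h
  obtain ⟨s, hs⟩ := lt_iSup_iff.1 h1
  obtain ⟨hs', hlt⟩ := lt_iSup_iff.1 hs
  intro x hx
  refine hs' x (hx.trans ?_)
  have : ENNReal.ofReal r < ENNReal.ofReal s := by simpa using hlt
  exact ((ENNReal.ofReal_lt_ofReal_iff_of_nonneg hr0.le).1 this).le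

theorem ofReal_le_reach {n : ℕ} {M : Set (EuclideanSpace ℝ (Fin n))} {τ : ℝ}
    (h : ∀ r, 0 < r → r < τ → HasUniqueProj M r) : ENNReal.ofReal τ ≤ reach M := by
  refine le_of_forall_lt fun a ha => ?_
  obtain ⟨b, hab, hb⟩ := exists_between ha
  have hbt : b ≠ ⊤ := hb.ne_top
  lift b to NNReal using hbt
  have hb0 : 0 < (b : ℝ) := by
    have : (0 : ENNReal) < b := bot_le.trans_lt hab
    exact_mod_cast this
  have hbτ : (b : ℝ) < τ := by
    rw [← ENNReal.ofReal_coe_nnreal] at hb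
    exact (ENNReal.ofReal_lt_ofReal_iff_of_nonneg b.2).1 hb
  refine hab.trans_le ?_
  exact le_iSup₂_of_le b (h b hb0 hbτ) le_rfl

/-- If `p` and `q` are both nearest to `x`, then `‖q - p‖² = 2⟪x - p, q - p⟫ ≤ ‖x - p‖‖q - p‖²/τ`,
and `‖x - p‖ ≤ r < τ` forces `q = p`. -/
theorem HasUniqueProj.of_inner_le {F : Type*} [NormedAddCommGroup F] [InnerProductSpace ℝ F]
    [FiniteDimensional ℝ F] {M : Set F} (hM : IsClosed M) (hne : M.Nonempty) {r τ : ℝ}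
    (hr : 0 < r) (hrτ : r < τ)
    (h : ∀ p ∈ M, ∀ x, (∀ q ∈ M, dist x p ≤ dist x q) → ∀ q ∈ M,
      ⟪x - p, q - p⟫ ≤ ‖x - p‖ * ‖q - p‖ ^ 2 / (2 * τ)) : HasUniqueProj M r := by
  have : ProperSpace F := FiniteDimensional.proper ℝ F
  intro x hx
  obtain ⟨p, hp, hpd⟩ := hM.exists_infDist_eq_dist hne x
  refine ⟨p, ⟨hp, hpd.symm⟩, fun q ⟨hq, hqd⟩ => ?_⟩
  have h1 := h p hp x (fun z hz => hpd ▸ infDist_le_dist_of_mem hz) q hq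
  rw [hpd] at hqd hx
  rw [dist_eq_norm, dist_eq_norm] at hqd
  rw [dist_eq_norm] at hx
  have h2 : ‖x - q‖ ^ 2 = ‖x - p‖ ^ 2 - 2 * ⟪x - p, q - p⟫ + ‖q - p‖ ^ 2 := by
    rw [← norm_sub_sq_real]; congr 2; abel
  rw [hqd] at h2
  have hτ : 0 < τ := hr.trans hrτ
  rw [le_div_iff₀ (by positivity)] at h1
  have h3 : ‖q - p‖ ^ 2 * (τ - ‖x - p‖) ≤ 0 := by nlinarith
  have h4 : ‖q - p‖ ^ 2 = 0 := by
    by_contra hne'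
    have : 0 < ‖q - p‖ ^ 2 := lt_of_le_of_ne (by positivity) (Ne.symm hne')
    nlinarith
  exact sub_eq_zero.1 (norm_eq_zero.1 (pow_eq_zero_iff two_ne_zero |>.1 h4))

theorem mem_orthogonal_of_nearest {F : Type*} [NormedAddCommGroup F] [InnerProductSpace ℝ F]
    {d : ℕ} {M : Set F} {q x : F} {T : Submodule ℝ F} (hT : IsTangent d M q T)
    (hx : ∀ z ∈ M, dist x q ≤ dist x z) : x - q ∈ Tᗮ := by
  rw [Submodule.mem_orthogonal']
  intro u hu
  have hd : HasFDerivAt (fun z => ‖x - z‖ ^ 2)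
      (2 • (innerSL ℝ (x - q)).comp (-ContinuousLinearMap.id ℝ F)) q :=
    ((hasFDerivAt_id q).const_sub x).norm_sq
  have hext : IsLocalExtrOn (fun z => ‖x - z‖ ^ 2) M q := by
    refine Or.inl (Filter.eventually_of_mem self_mem_nhdsWithin fun z hz => ?_)
    have := hx z hz
    rw [dist_eq_norm, dist_eq_norm] at this
    show ‖x - q‖ ^ 2 ≤ ‖x - z‖ ^ 2
    gcongr
  have := hT.fderiv_eq_zero_of_isLocalExtrOn hd hext hu
  simp only [two_smul, add_apply, ContinuousLinearMap.comp_apply,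
    neg_apply, ContinuousLinearMap.id_apply, innerSL_apply_apply,
    inner_neg_right] at this
  linarith

/-! ### Quantitative local geometry from Federer's inequality -/

/-- `T` is the field of tangent spaces of the closed `d`-dimensional submanifold `M`, and `M`
satisfies Federer's quadratic inequality characterizing reach at least `τ`. -/
structure HasTangentField {F : Type*} [NormedAddCommGroup F] [InnerProductSpace ℝ F] (d : ℕ)
    (M : Set F) (τ : ℝ) (T : F → Submodule ℝ F) : Prop where
  isClosed : IsClosed M
  pos : 0 < τ
  isTangent : ∀ p ∈ M, IsTangent d M p (T p)
  abs_inner_le : ∀ p ∈ M, ∀ ν ∈ (T p)ᗮ, ∀ q ∈ M, |⟪ν, q - p⟫| ≤ ‖ν‖ * ‖q - p‖ ^ 2 / (2 * τ)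

namespace HasTangentField

variable {F : Type*} [NormedAddCommGroup F] [InnerProductSpace ℝ F] [FiniteDimensional ℝ F]
  {d : ℕ} {M : Set F} {τ : ℝ} {T : F → Submodule ℝ F}

/-- Follow the distance `g` to `M` along the tangent ray. The vector from a nearest point is normal
there, so Federer's inequality at that point bounds the growth of `g`; a comparison argument then
keeps `g` below a quadratic barrier. -/
theorem infDist_le (h : HasTangentField d M τ T) {p u : F} (hp : p ∈ M) (hu : u ∈ T p)
    (hu1 : ‖u‖ = 1) {t : ℝ} (ht : 0 < t) : infDist (p + t • u) M ≤ 4 * t ^ 2 / τ := by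
  have : ProperSpace F := FiniteDimensional.proper ℝ F
  have hτ := h.pos
  choose q hqM hqd using fun s : ℝ => h.isClosed.exists_infDist_eq_dist ⟨p, hp⟩ (p + s • u)
  have hη : 0 < t / τ := by positivity
  obtain ⟨t₀, h1, h2⟩ := (((h.isTangent p hp).infDist_add_smul_le hu hη).and
    (Ioo_mem_nhdsGT ht)).exists
  have ht₀ : 0 < t₀ := h2.1
  set g : ℝ → ℝ := fun s => infDist (p + s • u) M with hg
  have hgc : Continuous g := (continuous_infDist_pt M).comp (by fun_prop)
  have hg0 : ∀ s, 0 ≤ g s := fun s => infDist_nonneg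
  have hgn : ∀ s, g s = ‖p + s • u - q s‖ := fun s => by rw [← dist_eq_norm]; exact hqd s
  -- The linear term dominates `g` at the starting time `t₀`, where tangency gives only `o(s)`; the
  -- coefficient `3` makes the barrier strict, and `b t = 4t²/τ`.
  set b : ℝ → ℝ := fun s => t / τ * s + 3 / τ * s ^ 2 with hb
  have hdb : ∀ s, HasDerivAt (fun s => b s ^ 2) (2 * b s * (t / τ + 6 / τ * s)) s := by
    intro s
    have : HasDerivAt b (t / τ * 1 + 3 / τ * (2 * s ^ 1 * 1)) s :=
      ((hasDerivAt_id s).const_mul (t / τ)).add (((hasDerivAt_id s).pow 2).const_mul (3 / τ))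
    refine (this.pow 2).congr_deriv ?_
    simp only [Nat.cast_ofNat, Nat.add_one_sub_one, pow_one, mul_one]
    ring
  -- Squares are compared because a fixed nearest point bounds the right slope of `g²` from above,
  -- without any differentiability of `g`.
  have key := image_le_of_liminf_slope_right_lt_deriv_boundary (a := t₀) (b := t)
    (f := fun s => g s ^ 2) (f' := fun s => 2 * ⟪u, p + s • u - q s⟫)
    (hgc.pow 2).continuousOn ?_ (B := fun s => b s ^ 2) ?_ hdb ?_ (right_mem_Icc.2 h2.2.le)
  · have hbt : b t = 4 * t ^ 2 / τ := by simp only [hb]; ring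
    rw [← hbt]
    exact le_of_sq_le_sq key (by simp only [hb]; positivity)
  · intro s hs r hr
    refine Eventually.frequently ?_
    filter_upwards [Ioo_mem_nhdsGT (show s < s + (r - 2 * ⟪u, p + s • u - q s⟫) by linarith)]
      with z hz
    have hzs : 0 < z - s := sub_pos.2 hz.1
    have e1 : g z ≤ ‖p + z • u - q s‖ := by
      rw [← dist_eq_norm]; exact infDist_le_dist_of_mem (hqM s)
    have e2 : g z ^ 2 ≤ ‖p + z • u - q s‖ ^ 2 := by have := hg0 z; gcongr
    have e3 : ‖p + z • u - q s‖ ^ 2 =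
        g s ^ 2 + 2 * (z - s) * ⟪u, p + s • u - q s⟫ + (z - s) ^ 2 := by
      have : p + z • u - q s = (p + s • u - q s) + (z - s) • u := by rw [sub_smul]; abel
      rw [this, norm_add_sq_real, real_inner_smul_right, norm_smul, hu1, mul_one,
        Real.norm_eq_abs, sq_abs, hgn, real_inner_comm]; ring
    rw [slope_def_field, div_lt_iff₀ hzs]
    nlinarith [hz.2]
  · have : g t₀ ≤ b t₀ := h1.trans (by simp only [hb]; have : 0 ≤ 3 / τ * t₀ ^ 2 := by positivity
                                       linarith)
    have := hg0 t₀
    show g t₀ ^ 2 ≤ b t₀ ^ 2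
    gcongr
  · intro s hs hgb
    have hs0 : 0 < s := ht₀.trans_le hs.1
    have hb0 : 0 < b s := by simp only [hb]; positivity
    have hgs : g s = b s := (pow_left_inj₀ (hg0 s) hb0.le two_ne_zero).1 hgb
    have hgle : g s ≤ s := by
      have : g s ≤ dist (p + s • u) p := infDist_le_dist_of_mem hp
      rwa [dist_eq_norm, add_sub_cancel_left, norm_smul, hu1, mul_one, Real.norm_eq_abs,
        abs_of_pos hs0] at this
    have hw : p + s • u - q s ∈ (T (q s))ᗮ := mem_orthogonal_of_nearest (h.isTangent _ (hqM s))
      fun z hz => by rw [← hqd]; exact infDist_le_dist_of_mem hz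
    have e1 := (abs_le.1 (h.abs_inner_le _ (hqM s) _ hw p hp)).1
    set w := p + s • u - q s with hwd
    have e2 : p - q s = w - s • u := by rw [hwd]; abel
    have e3 : ‖p - q s‖ ≤ 2 * s := by
      rw [e2]
      refine (norm_sub_le _ _).trans ?_
      rw [← hgn, norm_smul, hu1, mul_one, Real.norm_eq_abs, abs_of_pos hs0]; linarith
    have e4 : ⟪w, p - q s⟫ = g s ^ 2 - s * ⟪u, w⟫ := by
      rw [e2, inner_sub_right, real_inner_self_eq_norm_sq, real_inner_smul_right, hgn,
        real_inner_comm]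
    have e5 : ‖w‖ * ‖p - q s‖ ^ 2 / (2 * τ) ≤ g s * (2 * s) ^ 2 / (2 * τ) := by
      rw [← hgn]; have := hg0 s; gcongr
    have e6 : s * ⟪u, w⟫ ≤ s * (b s * (t / τ + 5 / τ * s)) := by
      have : s * (b s * (t / τ + 5 / τ * s)) = b s ^ 2 + b s * (2 * s) ^ 2 / (2 * τ) := by
        have : b s ^ 2 = b s * (t / τ * s + 3 / τ * s ^ 2) := by rw [pow_two]
        rw [this]; field_simp; ring
      rw [this, ← hgs]; linarith
    have e7 := le_of_mul_le_mul_left e6 hs0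
    have e8 : b s * (t / τ + 5 / τ * s) < b s * (t / τ + 6 / τ * s) := by gcongr; norm_num
    linarith

theorem exists_norm_sub_le (h : HasTangentField d M τ T) {p u : F} (hp : p ∈ M) (hu : u ∈ T p)
    (hu1 : ‖u‖ = 1) {t : ℝ} (ht : 0 < t) : ∃ z ∈ M, ‖z - p - t • u‖ ≤ 4 * t ^ 2 / τ := by
  have : ProperSpace F := FiniteDimensional.proper ℝ F
  obtain ⟨z, hz, hzd⟩ := h.isClosed.exists_infDist_eq_dist ⟨p, hp⟩ (p + t • u)
  refine ⟨z, hz, ?_⟩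
  rw [sub_sub, ← dist_eq_norm, dist_comm, ← hzd]
  exact h.infDist_le hp hu hu1 ht

/-- A unit tangent vector at `q` normal to `M` at `p` would lead, after a step `τ/10`, to a point of
`M` too high above the tangent space at `p` for Federer's inequality. -/
theorem inf_orthogonal_eq_bot (h : HasTangentField d M τ T) {p q : F} (hp : p ∈ M) (hq : q ∈ M)
    (hpq : ‖q - p‖ ≤ τ / 100) : T q ⊓ (T p)ᗮ = ⊥ := by
  rw [Submodule.eq_bot_iff]
  rintro u' ⟨hu', hν'⟩
  by_contra hne
  have hn : 0 < ‖u'‖ := norm_pos_iff.2 hne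
  set u := ‖u'‖⁻¹ • u' with hu_def
  have hu : u ∈ T q := Submodule.smul_mem _ _ hu'
  have hν : u ∈ (T p)ᗮ := Submodule.smul_mem _ _ hν'
  have hu1 : ‖u‖ = 1 := by rw [hu_def, norm_smul, norm_inv, norm_norm, inv_mul_cancel₀ hn.ne']
  have hτ := h.pos
  obtain ⟨z, hz, hzd⟩ := h.exists_norm_sub_le hq hu hu1 (t := τ / 10) (by positivity)
  have e0 : 4 * (τ / 10) ^ 2 / τ = τ / 25 := by field_simp; norm_num
  rw [e0] at hzd
  have e1 := (abs_le.1 (h.abs_inner_le p hp u hν z hz)).2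
  have e2 := (abs_le.1 (h.abs_inner_le p hp u hν q hq)).1
  rw [hu1, one_mul] at e1 e2
  have e3 : z - p = (z - q - (τ / 10) • u) + (q - p) + (τ / 10) • u := by abel
  have e4 : ⟪u, z - p⟫ = ⟪u, z - q - (τ / 10) • u⟫ + ⟪u, q - p⟫ + τ / 10 := by
    rw [e3, inner_add_right, inner_add_right, real_inner_smul_right, real_inner_self_eq_norm_sq,
      hu1]; ring
  have e5 := (abs_le.1 (abs_real_inner_le_norm u (z - q - (τ / 10) • u))).1
  rw [hu1, one_mul] at e5
  have e6 : ‖z - p‖ ≤ 3 * τ / 20 := by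
    rw [e3]
    refine (norm_add₃_le).trans ?_
    rw [norm_smul, hu1, Real.norm_eq_abs, abs_of_pos (by positivity)]; linarith
  have e7 : ‖z - p‖ ^ 2 / (2 * τ) ≤ (3 * τ / 20) ^ 2 / (2 * τ) := by gcongr
  have e8 : ‖q - p‖ ^ 2 / (2 * τ) ≤ (τ / 100) ^ 2 / (2 * τ) := by gcongr
  have e9 : (3 * τ / 20) ^ 2 / (2 * τ) = 9 * τ / 800 := by field_simp; norm_num
  have e10 : (τ / 100) ^ 2 / (2 * τ) = τ / 20000 := by field_simp; norm_num
  linarith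

/-- A connectedness argument: the image is open by transversality, and closed within the ball
because points of `M` at distance exactly `r` from `p` project outside radius `ρ`. -/
theorem ball_subset_image_orthogonalProjection (h : HasTangentField d M τ T) {p : F} (hp : p ∈ M)
    {r ρ : ℝ} (hr : r ≤ τ / 100) (hr0 : 0 < r) (hρ : 0 < ρ)
    (hρr : ρ ^ 2 ≤ r ^ 2 * (1 - r ^ 2 / (4 * τ ^ 2))) :
    ball ((T p).orthogonalProjectionOnto p) ρ ⊆
      (T p).orthogonalProjectionOnto '' (M ∩ ball p r) := by
  have : ProperSpace F := FiniteDimensional.proper ℝ F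
  have hτ := h.pos
  set π := (T p).orthogonalProjectionOnto with hπ
  refine (convex_ball _ _).isPreconnected.subset_of_closure_inter_subset ?_ ?_ ?_
  · rw [isOpen_iff_mem_nhds]
    rintro _ ⟨q, ⟨hq, hqr⟩, rfl⟩
    have hqp : ‖q - p‖ ≤ τ / 100 := by rw [← dist_eq_norm]; exact (mem_ball.1 hqr).le.trans hr
    rw [← (h.isTangent q hq).map_orthogonalProjectionOnto (h.isTangent p hp).finrank_eq
      (h.inf_orthogonal_eq_bot hp hq hqp)]
    exact image_mem_map (inter_mem self_mem_nhdsWithin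
      (mem_nhdsWithin_of_mem_nhds (isOpen_ball.mem_nhds hqr)))
  · exact ⟨π p, mem_ball_self hρ, p, ⟨hp, mem_ball_self hr0⟩, rfl⟩
  · rintro y ⟨hy, hyρ⟩
    have hc : IsCompact (π '' (M ∩ closedBall p r)) :=
      ((isCompact_closedBall p r).inter_left h.isClosed).image π.continuous
    obtain ⟨q, ⟨hq, hqr⟩, rfl⟩ := closure_minimal
      (image_mono (inter_subset_inter_right M ball_subset_closedBall)) hc.isClosed hy
    refine ⟨q, ⟨hq, mem_ball.2 (lt_of_le_of_ne hqr fun he => ?_)⟩, rfl⟩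
    rw [dist_eq_norm] at he
    have hyρ' : ‖π (q - p)‖ < ρ := by rw [map_sub, ← dist_eq_norm]; exact hyρ
    set w := (q - p) - (π (q - p) : F) with hw
    have hwo : w ∈ (T p)ᗮ := Submodule.sub_starProjection_mem_orthogonal _
    have e0 : ⟪w, (π (q - p) : F)⟫ = 0 :=
      Submodule.inner_left_of_mem_orthogonal (π (q - p)).2 hwo
    have e1 : q - p = w + (π (q - p) : F) := by rw [hw]; abel
    have e2 : ‖q - p‖ ^ 2 = ‖w‖ ^ 2 + ‖π (q - p)‖ ^ 2 := by
      conv_lhs => rw [e1, norm_add_sq_real, e0]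
      simp
    have e3 : ⟪w, q - p⟫ = ‖w‖ ^ 2 := by
      conv_lhs => rw [e1, inner_add_right, e0, real_inner_self_eq_norm_sq]
      simp
    have e4 := (abs_le.1 (h.abs_inner_le p hp w hwo q hq)).2
    rw [e3, he] at e4
    have e5 : ‖w‖ ≤ r ^ 2 / (2 * τ) := by
      rcases (norm_nonneg w).eq_or_lt with h0 | h0
      · rw [← h0]; positivity
      · refine le_of_mul_le_mul_left ?_ h0
        rw [← pow_two, ← mul_div_assoc]; exact e4
    have e6 : ‖w‖ ^ 2 ≤ (r ^ 2 / (2 * τ)) ^ 2 := by gcongr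
    have e7 : ‖π (q - p)‖ ^ 2 < ρ ^ 2 := by gcongr
    have e8 : (r ^ 2 / (2 * τ)) ^ 2 = r ^ 2 * (r ^ 2 / (4 * τ ^ 2)) := by field_simp; norm_num
    rw [he] at e2
    linarith

end HasTangentField

/-! ### Volume lower bound and the orthogonal direction -/

theorem LipschitzOnWith.euclideanHausdorffMeasure_image_le {X Y : Type*} [EMetricSpace X]
    [MeasurableSpace X] [BorelSpace X] [EMetricSpace Y] [MeasurableSpace Y] [BorelSpace Y]
    {f : X → Y} {s : Set X} (h : LipschitzOnWith 1 f s) (d : ℕ) :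
    Measure.euclideanHausdorffMeasure d (f '' s) ≤ Measure.euclideanHausdorffMeasure d s := by
  simp_rw [Measure.euclideanHausdorffMeasure_def, Measure.smul_apply]
  gcongr
  simpa using h.hausdorffMeasure_image_le (d := d) (by positivity)

theorem euclideanHausdorffMeasure_ball {F : Type*} [NormedAddCommGroup F] [InnerProductSpace ℝ F]
    [FiniteDimensional ℝ F] [MeasurableSpace F] [BorelSpace F] {d : ℕ}
    (hd : Module.finrank ℝ F = d) (x : F) {ρ : ℝ} (hρ : 0 < ρ) :
    Measure.euclideanHausdorffMeasure d (ball x ρ) =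
      ENNReal.ofReal (ρ ^ d * unitBallVolume d) := by
  subst hd
  rw [InnerProductSpace.euclideanHausdorffMeasure_eq_volume, Measure.addHaar_ball_of_pos _ _ hρ,
    ENNReal.ofReal_mul (by positivity), unitBallVolume, Measure.real,
    ENNReal.ofReal_toReal measure_ball_lt_top.ne,
    ← (stdOrthonormalBasis ℝ F).measurePreserving_repr.measure_preimage
      measurableSet_ball.nullMeasurableSet]
  congr 2
  ext y
  simp

theorem HasTangentField.le_euclideanHausdorffMeasure {F : Type*} [NormedAddCommGroup F]
    [InnerProductSpace ℝ F] [FiniteDimensional ℝ F] [MeasurableSpace F] [BorelSpace F]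
    {d : ℕ} {M : Set F} {τ : ℝ} {T : F → Submodule ℝ F} (h : HasTangentField d M τ T) {p : F}
    (hp : p ∈ M) {r : ℝ} (hr : r ≤ τ / 100) (hr0 : 0 < r) (hdr : 2 * d * r ≤ τ) :
    ENNReal.ofReal (r ^ d / 2 * unitBallVolume d) ≤
      Measure.euclideanHausdorffMeasure d (M ∩ ball p r) := by
  have hτ := h.pos
  -- The projection covers a ball of radius `r(1 - a)`, as `(1 - a)² ≤ 1 - a`. Since `2dr ≤ τ` gives
  -- `da ≤ 1/2`, Bernoulli's inequality costs only a factor `2` in volume, independently of `d`.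
  set a := r ^ 2 / (4 * τ ^ 2) with ha
  have hrτ : r ^ 2 ≤ (τ / 100) ^ 2 := by gcongr
  have ha0 : 0 ≤ a := by positivity
  have ha1 : a ≤ 1 / 40000 := by
    rw [ha, div_le_iff₀ (by positivity)]; nlinarith
  have hda : d * a ≤ 1 / 2 := by
    have e1 : d * r ^ 2 ≤ τ * τ := by nlinarith
    rw [ha, ← mul_div_assoc, div_le_iff₀ (by positivity)]; nlinarith
  have hρ : 0 < r * (1 - a) := mul_pos hr0 (by linarith)
  have hsub := h.ball_subset_image_orthogonalProjection hp hr hr0 hρ (by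
    rw [mul_pow]; gcongr; nlinarith)
  have hL : LipschitzOnWith 1 (T p).orthogonalProjectionOnto (M ∩ ball p r) :=
    (T p).lipschitzWith_orthogonalProjectionOnto.lipschitzOnWith
  refine le_trans ?_ (hL.euclideanHausdorffMeasure_image_le d)
  refine le_trans ?_ (measure_mono hsub)
  rw [euclideanHausdorffMeasure_ball (h.isTangent p hp).finrank_eq _ hρ]
  refine ENNReal.ofReal_le_ofReal ?_
  have hb : 1 / 2 ≤ (1 - a) ^ d := by
    have := one_add_mul_le_pow (a := -a) (by linarith) d
    rw [← sub_eq_add_neg] at this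
    linarith
  have hω : 0 ≤ unitBallVolume d := measureReal_nonneg
  rw [mul_pow, div_eq_mul_one_div]
  gcongr

namespace HasTangentField

variable {F : Type*} [NormedAddCommGroup F] [InnerProductSpace ℝ F] [FiniteDimensional ℝ F]
  {d : ℕ} {M : Set F} {τ : ℝ} {T : F → Submodule ℝ F}

theorem card_mul_le [MeasurableSpace F] [BorelSpace F] (h : HasTangentField d M τ T) {V r : ℝ}
    (hV : Measure.euclideanHausdorffMeasure d M ≤ ENNReal.ofReal V)
    (hr : r ≤ τ / 100) (hr0 : 0 < r) (hdr : 2 * d * r ≤ τ) {s : Finset F} (hs : ↑s ⊆ M)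
    (hsep : (s : Set F).Pairwise fun x y => 2 * r ≤ dist x y) :
    ENNReal.ofReal (s.card * (r ^ d / 2 * unitBallVolume d)) ≤ ENNReal.ofReal V := by
  have hdisj : (s : Set F).PairwiseDisjoint fun p => M ∩ ball p r := by
    intro x hx y hy hxy
    refine (ball_disjoint_ball ?_).mono inter_subset_right inter_subset_right
    linarith [hsep hx hy hxy]
  have h1 := measure_biUnion_finset (μ := Measure.euclideanHausdorffMeasure d) hdisj
    fun p _ => h.isClosed.measurableSet.inter measurableSet_ball
  have h2 : s.card • ENNReal.ofReal (r ^ d / 2 * unitBallVolume d) ≤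
      ∑ p ∈ s, Measure.euclideanHausdorffMeasure d (M ∩ ball p r) :=
    Finset.card_nsmul_le_sum _ _ _ fun p hp =>
      h.le_euclideanHausdorffMeasure (hs hp) hr hr0 hdr
  rw [ENNReal.ofReal_mul (by positivity), ENNReal.ofReal_natCast, ← nsmul_eq_mul]
  refine h2.trans (h1 ▸ (measure_mono ?_).trans hV)
  exact iUnion₂_subset fun p _ => inter_subset_left

/-- A separated set of maximal cardinality has fewer than `dim F` points, so its span has a nonzero
orthogonal vector; maximality makes the set a `2r`-net. -/
theorem exists_unit_orthogonal_net [MeasurableSpace F] [BorelSpace F]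
    (h : HasTangentField d M τ T) {V r : ℝ}
    (hV : Measure.euclideanHausdorffMeasure d M ≤ ENNReal.ofReal V)
    (hr : r ≤ τ / 100) (hr0 : 0 < r) (hdr : 2 * d * r ≤ τ) (hn0 : 0 < Module.finrank ℝ F)
    (hn : V / (r ^ d / 2 * unitBallVolume d) < Module.finrank ℝ F) :
    ∃ v : F, ‖v‖ = 1 ∧ ∀ x ∈ M, ∃ p ∈ M, ‖x - p‖ ≤ 2 * r ∧ ⟪v, p⟫ = 0 := by
  classical
  set n := Module.finrank ℝ F
  set P : ℕ → Prop := fun k => ∃ s : Finset F, ↑s ⊆ M ∧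
    ((s : Set F).Pairwise fun x y => 2 * r ≤ dist x y) ∧ s.card = k with hP
  have hω : 0 < unitBallVolume d := by
    rw [unitBallVolume, Measure.real]
    exact ENNReal.toReal_pos (measure_ball_pos _ _ one_pos).ne' measure_ball_lt_top.ne
  have hlt : ∀ k, P k → k < n := by
    rintro k ⟨s, hs, hsep, rfl⟩
    rcases Nat.eq_zero_or_pos s.card with h0 | h0
    · rwa [h0]
    have h1 := h.card_mul_le hV hr hr0 hdr hs hsep
    have hpos : 0 < (s.card : ℝ) * (r ^ d / 2 * unitBallVolume d) := by positivity
    rw [ENNReal.ofReal_le_ofReal_iff'] at h1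
    have h2 := h1.resolve_right (not_le.2 hpos)
    rw [← le_div_iff₀ (by positivity)] at h2
    exact_mod_cast h2.trans_lt hn
  have hP0 : P 0 := ⟨∅, by simp, by simp, rfl⟩
  set k := Nat.findGreatest P n with hk
  have hPk : P k := Nat.findGreatest_spec (Nat.zero_le n) hP0
  have hPk1 : ¬ P (k + 1) := Nat.findGreatest_is_greatest (Nat.lt_succ_self k) (hlt k hPk)
  have hkn := hlt k hPk
  obtain ⟨s, hs, hsep, hcard⟩ := hPk
  have hspan : Submodule.span ℝ (s : Set F) ≠ ⊤ := by
    intro he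
    have := finrank_span_finset_le_card (R := ℝ) s
    rw [Set.finrank, he, finrank_top] at this
    omega
  obtain ⟨v, hv, hv0⟩ := Submodule.exists_mem_ne_zero_of_ne_bot
    (fun hb => hspan (Submodule.orthogonal_eq_bot_iff.1 hb))
  have hvn : 0 < ‖v‖ := norm_pos_iff.2 hv0
  refine ⟨‖v‖⁻¹ • v, by rw [norm_smul, norm_inv, norm_norm, inv_mul_cancel₀ hvn.ne'],
    fun x hx => ?_⟩
  by_contra! hc
  refine hPk1 ⟨insert x s, ?_, ?_, ?_⟩
  · rw [Finset.coe_insert]; exact insert_subset hx hs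
  all_goals
    have hfar : ∀ p ∈ s, 2 * r < dist x p := by
      intro p hp
      by_contra! hle
      refine hc p (hs hp) (by rwa [← dist_eq_norm]) ?_
      rw [real_inner_smul_left,
        Submodule.inner_left_of_mem_orthogonal (Submodule.subset_span hp) hv, mul_zero]
  · rw [Finset.coe_insert]
    refine hsep.insert fun p hp _ => ⟨(hfar p hp).le, ?_⟩
    rw [dist_comm]; exact (hfar p hp).le
  · rw [Finset.card_insert_of_notMem, hcard]
    intro hxs
    have := hfar x hxs
    rw [dist_self] at this
    linarith

/-! ### Slopes of secants and the bound on `τ` -/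

theorem exists_decomposition (h : HasTangentField d M τ T) {p q : F} (hp : p ∈ M) (hq : q ∈ M) :
    ∃ a ∈ T p, ∃ w, q - p = a + w ∧ ‖a‖ ≤ ‖q - p‖ ∧ ‖w‖ ≤ ‖q - p‖ ^ 2 / (2 * τ) := by
  have hτ := h.pos
  set a := (T p).starProjection (q - p) with ha
  have haT : a ∈ T p := Submodule.starProjection_apply_mem _ _
  have hw : q - p - a ∈ (T p)ᗮ := Submodule.sub_starProjection_mem_orthogonal _
  refine ⟨a, haT, q - p - a, by abel, Submodule.norm_starProjection_apply_le _ _, ?_⟩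
  set w := q - p - a with hwd
  have e0 : ⟪w, a⟫ = 0 := Submodule.inner_left_of_mem_orthogonal haT hw
  have e1 : ⟪w, q - p⟫ = ‖w‖ * ‖w‖ := by
    have : q - p = w + a := by rw [hwd]; abel
    rw [this, inner_add_right, e0, real_inner_self_eq_norm_mul_norm, add_zero]
  have e2 := (abs_le.1 (h.abs_inner_le p hp w hw q hq)).2
  rcases (norm_nonneg w).eq_or_lt with h0 | h0
  · rw [← h0]; positivity
  · refine le_of_mul_le_mul_left ?_ h0
    rwa [← e1, ← mul_div_assoc]

/-- For secants longer than `στ`, divide the height difference by the length. For shorter ones, a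
tangent step of length `στ` stays within `4σ²τ` of `M`, so tangent slopes are at most `(4 + 2)σ`,
and the normal part of the secant adds `σ/2`. -/
theorem abs_inner_sub_le (h : HasTangentField d M τ T) {v : F} (hv : ‖v‖ = 1) {σ : ℝ}
    (hσ : 0 < σ) (hnet : ∀ x ∈ M, |⟪v, x⟫| ≤ σ ^ 2 * τ) {p q : F} (hp : p ∈ M) (hq : q ∈ M) :
    |⟪v, q - p⟫| ≤ 13 / 2 * σ * ‖q - p‖ := by
  have hτ := h.pos
  rcases le_total (‖q - p‖) (σ * τ) with hle | hge
  · have htan : ∀ a ∈ T p, |⟪v, a⟫| ≤ 6 * σ * ‖a‖ := by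
      intro a ha
      rcases eq_or_ne a 0 with rfl | ha0
      · simp
      have hn : 0 < ‖a‖ := norm_pos_iff.2 ha0
      have hu1 : ‖‖a‖⁻¹ • a‖ = 1 := by rw [norm_smul, norm_inv, norm_norm, inv_mul_cancel₀ hn.ne']
      obtain ⟨z, hz, hzd⟩ := h.exists_norm_sub_le hp (Submodule.smul_mem _ _ ha) hu1
        (t := σ * τ) (by positivity)
      have e0 : 4 * (σ * τ) ^ 2 / τ = 4 * (σ ^ 2 * τ) := by field_simp
      rw [e0] at hzd
      have e1 := abs_real_inner_le_norm v (z - p - (σ * τ) • ‖a‖⁻¹ • a)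
      rw [hv, one_mul] at e1
      have e2 : σ * τ * (‖a‖⁻¹ * ⟪v, a⟫) =
          ⟪v, z⟫ - ⟪v, p⟫ - ⟪v, z - p - (σ * τ) • ‖a‖⁻¹ • a⟫ := by
        simp only [inner_sub_right, real_inner_smul_right]; ring
      have e3 : |σ * τ * (‖a‖⁻¹ * ⟪v, a⟫)| ≤ 6 * (σ ^ 2 * τ) := by
        rw [e2]
        refine (abs_sub _ _).trans ?_
        have := abs_sub ⟪v, z⟫ ⟪v, p⟫
        linarith [hnet z hz, hnet p hp]
      rw [abs_mul, abs_mul _ ⟪v, a⟫, abs_of_pos (by positivity : 0 < σ * τ),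
        abs_of_pos (inv_pos.2 hn)] at e3
      have e4 := mul_le_mul_of_nonneg_left e3 (by positivity : 0 ≤ ‖a‖ / (σ * τ))
      have e5 : ‖a‖ / (σ * τ) * (σ * τ * (‖a‖⁻¹ * |⟪v, a⟫|)) = |⟪v, a⟫| := by field_simp
      have e6 : ‖a‖ / (σ * τ) * (6 * (σ ^ 2 * τ)) = 6 * σ * ‖a‖ := by field_simp
      linarith
    obtain ⟨a, ha, w, hqp, han, hwn⟩ := h.exists_decomposition hp hq
    have e1 : ‖w‖ ≤ σ / 2 * ‖q - p‖ := by
      refine hwn.trans ?_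
      rw [div_le_iff₀ (by positivity)]
      nlinarith [norm_nonneg (q - p)]
    have e2 := abs_real_inner_le_norm v w
    rw [hv, one_mul] at e2
    have e3 := htan a ha
    have e4 : 6 * σ * ‖a‖ ≤ 6 * σ * ‖q - p‖ := by gcongr
    have e5 : |⟪v, q - p⟫| ≤ |⟪v, a⟫| + |⟪v, w⟫| := by
      rw [hqp, inner_add_right]; exact abs_add_le _ _
    linarith
  · rw [inner_sub_right]
    have := abs_sub ⟪v, q⟫ ⟪v, p⟫
    have e1 := mul_le_mul_of_nonneg_left hge hσ.le
    have e2 : 0 ≤ σ * ‖q - p‖ := by positivity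
    linarith [hnet q hq, hnet p hp]

/-- For a pair realizing the diameter, `q - p` is normal at `p`, so Federer's inequality gives `2τ ≤
‖q - p‖ ≤ 2` unless `p = q`. -/
theorem subsingleton_or_le_one (h : HasTangentField d M τ T) (hb : M ⊆ closedBall 0 1)
    (hne : M.Nonempty) : M.Subsingleton ∨ τ ≤ 1 := by
  have : ProperSpace F := FiniteDimensional.proper ℝ F
  have hτ := h.pos
  have hc : IsCompact M := (isCompact_closedBall 0 1).of_isClosed_subset h.isClosed hb
  obtain ⟨⟨p, q⟩, ⟨hp, hq⟩, hmax⟩ := (hc.prod hc).exists_isMaxOn (hne.prod hne)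
    (f := fun z : F × F => ‖z.1 - z.2‖) (by fun_prop)
  have hmax' : ∀ x ∈ M, ∀ y ∈ M, ‖x - y‖ ≤ ‖p - q‖ := fun x hx y hy =>
    hmax (show (x, y) ∈ M ×ˢ M from ⟨hx, hy⟩)
  rcases eq_or_ne p q with rfl | hpq
  · left
    intro x hx y hy
    have := hmax' x hx y hy
    rw [sub_self, norm_zero] at this
    exact sub_eq_zero.1 (norm_le_zero_iff.1 this)
  · right
    have hν : q - p ∈ (T p)ᗮ := by
      rw [Submodule.mem_orthogonal']
      intro u hu
      have hd : HasFDerivAt (fun z => ‖q - z‖ ^ 2)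
          (2 • (innerSL ℝ (q - p)).comp (-ContinuousLinearMap.id ℝ F)) p :=
        ((hasFDerivAt_id p).const_sub q).norm_sq
      have hext : IsLocalExtrOn (fun z => ‖q - z‖ ^ 2) M p := by
        refine Or.inr (Filter.eventually_of_mem self_mem_nhdsWithin fun z hz => ?_)
        have := hmax' z hz q hq
        rw [norm_sub_rev, norm_sub_rev p q] at this
        show ‖q - z‖ ^ 2 ≤ ‖q - p‖ ^ 2
        gcongr
      have := (h.isTangent p hp).fderiv_eq_zero_of_isLocalExtrOn hd hext hu
      simp only [two_smul, add_apply, ContinuousLinearMap.comp_apply,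
        neg_apply, ContinuousLinearMap.id_apply, innerSL_apply_apply,
        inner_neg_right] at this
      linarith
    have e1 := (abs_le.1 (h.abs_inner_le p hp _ hν q hq)).2
    rw [real_inner_self_eq_norm_sq, le_div_iff₀ (by positivity)] at e1
    have hpos : 0 < ‖q - p‖ := norm_pos_iff.2 (sub_ne_zero.2 hpq.symm)
    have e2 : 2 * τ ≤ ‖q - p‖ := by
      have : ‖q - p‖ ^ 2 * (2 * τ) ≤ ‖q - p‖ ^ 2 * ‖q - p‖ := by linarith
      exact le_of_mul_le_mul_left this (by positivity)
    have e3 := norm_sub_le q p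
    have e4 := mem_closedBall_zero_iff.1 (hb hp)
    have e5 := mem_closedBall_zero_iff.1 (hb hq)
    linarith

end HasTangentField

theorem ManifoldClass.exists_hasTangentField {d n : ℕ} {V τ : ℝ}
    {M : Set (EuclideanSpace ℝ (Fin n))} (h : ManifoldClass d n V τ M) :
    ∃ T, HasTangentField d M τ T := by
  classical
  choose! T hT using fun p (hp : p ∈ M) => h.submanifold.exists_isTangent hp
  exact ⟨T, h.isClosed, h.tau_pos, hT, fun p hp ν hν q hq =>
    abs_inner_le_of_forall_hasUniqueProj h.isClosed h.tau_pos
      (fun r h0 h1 => hasUniqueProj_of_lt_reach h.reach_ge h0 h1) (hT p hp) hp hν hq⟩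

/-! ### The paraboloid lift -/

section

variable {F : Type*} [NormedAddCommGroup F] [InnerProductSpace ℝ F]

/-- The projection along `v`; it is orthogonal when `v` is a unit vector. -/
noncomputable def projAlong (v : F) : F →L[ℝ] F :=
  ContinuousLinearMap.id ℝ F - (innerSL ℝ v).smulRight v

/-- Project along `v`, lift to a paraboloid with axis `v`, and scale by `s`. -/
noncomputable def liftMap (v : F) (δ s : ℝ) (x : F) : F :=
  s • (projAlong v x + (δ / 2 * ‖projAlong v x‖ ^ 2) • v)

/-- The derivative of `liftMap v δ s` at `x`. -/
noncomputable def liftMapDeriv (v : F) (δ s : ℝ) (x : F) : F →L[ℝ] F :=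
  s • (projAlong v + (δ • (innerSL ℝ (projAlong v x)).comp (projAlong v)).smulRight v)

variable {v : F} {δ s : ℝ}

theorem projAlong_apply (v x : F) : projAlong v x = x - ⟪v, x⟫ • v := rfl

theorem inner_projAlong (hv : ‖v‖ = 1) (x : F) : ⟪v, projAlong v x⟫ = 0 := by
  rw [projAlong_apply, inner_sub_right, real_inner_smul_right, real_inner_self_eq_norm_sq, hv]
  ring

theorem norm_projAlong_sq (hv : ‖v‖ = 1) (x : F) :
    ‖projAlong v x‖ ^ 2 = ‖x‖ ^ 2 - ⟪v, x⟫ ^ 2 := by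
  rw [projAlong_apply, norm_sub_sq_real, real_inner_smul_right, norm_smul, hv, mul_one,
    Real.norm_eq_abs, sq_abs, real_inner_comm x v]
  ring

theorem norm_projAlong_le (hv : ‖v‖ = 1) (x : F) : ‖projAlong v x‖ ≤ ‖x‖ := by
  refine le_of_sq_le_sq ?_ (norm_nonneg _)
  rw [norm_projAlong_sq hv]
  linarith [sq_nonneg ⟪v, x⟫]

theorem norm_projAlong_add_smul_sq (hv : ‖v‖ = 1) (x : F) (c : ℝ) :
    ‖projAlong v x + c • v‖ ^ 2 = ‖projAlong v x‖ ^ 2 + c ^ 2 := by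
  rw [norm_add_sq_real, real_inner_smul_right, real_inner_comm, inner_projAlong hv, norm_smul, hv,
    mul_one, Real.norm_eq_abs, sq_abs]
  ring

theorem contDiff_liftMap : ContDiff ℝ 3 (liftMap v δ s) := by
  have h1 : ContDiff ℝ 3 (fun x => projAlong v x) := (projAlong v).contDiff
  have h2 : ContDiff ℝ 3 (fun x => ‖projAlong v x‖ ^ 2) := h1.norm_sq ℝ
  exact contDiff_const.smul (h1.add ((contDiff_const.mul h2).smul contDiff_const))

theorem hasFDerivAt_liftMap (x : F) :
    HasFDerivAt (liftMap v δ s) (liftMapDeriv v δ s x) x := by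
  have h1 : HasFDerivAt (fun x => projAlong v x) (projAlong v) x := (projAlong v).hasFDerivAt
  have h2 := ((h1.norm_sq.const_mul (δ / 2)).smul_const v)
  refine ((h1.add h2).const_smul s).congr_fderiv ?_
  ext y
  simp only [liftMapDeriv, smul_apply, add_apply, ContinuousLinearMap.smulRight_apply,
    ContinuousLinearMap.comp_apply, two_smul, innerSL_apply_apply, smul_eq_mul]
  congr 3
  ring

theorem liftMap_sub_liftMap (x y : F) : liftMap v δ s x - liftMap v δ s y =
    s • (projAlong v (x - y) +
      (δ / 2 * (‖projAlong v x‖ ^ 2 - ‖projAlong v y‖ ^ 2)) • v) := by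
  simp only [liftMap, map_sub, ← smul_sub, mul_sub, sub_smul]
  congr 1
  abel

theorem norm_liftMap_sub_sq (hv : ‖v‖ = 1) (x y : F) :
    ‖liftMap v δ s x - liftMap v δ s y‖ ^ 2 = s ^ 2 * (‖projAlong v (x - y)‖ ^ 2 +
      (δ / 2 * (‖projAlong v x‖ ^ 2 - ‖projAlong v y‖ ^ 2)) ^ 2) := by
  rw [liftMap_sub_liftMap, norm_smul, mul_pow, Real.norm_eq_abs, sq_abs,
    norm_projAlong_add_smul_sq hv]

/-- On the unit ball the lift stretches squared lengths by at most `1 + δ²`, which cancels one of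
the two factors `s`. The remaining factor is kept for the exposedness estimate. -/
theorem norm_liftMap_sub_sq_le (hv : ‖v‖ = 1) (hs : s * (1 + δ ^ 2) = 1)
    {x y : F} (hx : ‖x‖ ≤ 1) (hy : ‖y‖ ≤ 1) :
    ‖liftMap v δ s x - liftMap v δ s y‖ ^ 2 ≤ s * ‖projAlong v (x - y)‖ ^ 2 := by
  rw [norm_liftMap_sub_sq hv]
  have h1 : (‖projAlong v x‖ ^ 2 - ‖projAlong v y‖ ^ 2) ^ 2 ≤ 4 * ‖projAlong v (x - y)‖ ^ 2 := by
    have a := (norm_projAlong_le hv x).trans hx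
    have b := (norm_projAlong_le hv y).trans hy
    have c := abs_norm_sub_norm_le (projAlong v x) (projAlong v y)
    rw [← map_sub] at c
    have e1 : (‖projAlong v x‖ - ‖projAlong v y‖) ^ 2 ≤ ‖projAlong v (x - y)‖ ^ 2 := by
      rw [← sq_abs (‖projAlong v x‖ - ‖projAlong v y‖)]; gcongr
    have e2 : (‖projAlong v x‖ + ‖projAlong v y‖) ^ 2 ≤ 2 ^ 2 := by gcongr; linarith
    calc (‖projAlong v x‖ ^ 2 - ‖projAlong v y‖ ^ 2) ^ 2
        = (‖projAlong v x‖ + ‖projAlong v y‖) ^ 2 * (‖projAlong v x‖ - ‖projAlong v y‖) ^ 2 := by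
          ring
      _ ≤ 2 ^ 2 * ‖projAlong v (x - y)‖ ^ 2 := by gcongr
      _ = _ := by norm_num
  have h2 : (δ / 2 * (‖projAlong v x‖ ^ 2 - ‖projAlong v y‖ ^ 2)) ^ 2 ≤
      δ ^ 2 * ‖projAlong v (x - y)‖ ^ 2 := by
    rw [mul_pow, div_pow]
    have := mul_le_mul_of_nonneg_left h1 (sq_nonneg δ)
    linarith
  calc _ ≤ s ^ 2 * (‖projAlong v (x - y)‖ ^ 2 + δ ^ 2 * ‖projAlong v (x - y)‖ ^ 2) := by gcongr
    _ = s * (s * (1 + δ ^ 2)) * ‖projAlong v (x - y)‖ ^ 2 := by ring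
    _ = _ := by rw [hs, mul_one]

theorem lipschitzOnWith_liftMap (hv : ‖v‖ = 1) (hs : s * (1 + δ ^ 2) = 1)
    (hs1 : s ≤ 1) : LipschitzOnWith 1 (liftMap v δ s) (closedBall 0 1) := by
  refine LipschitzOnWith.of_dist_le_mul fun x hx y hy => ?_
  rw [dist_eq_norm, dist_eq_norm, NNReal.coe_one, one_mul]
  refine le_of_sq_le_sq ?_ (norm_nonneg _)
  refine (norm_liftMap_sub_sq_le hv hs (mem_closedBall_zero_iff.1 hx)
    (mem_closedBall_zero_iff.1 hy)).trans ?_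
  have h1 := norm_projAlong_le hv (x - y)
  calc s * ‖projAlong v (x - y)‖ ^ 2 ≤ 1 * ‖x - y‖ ^ 2 := by gcongr
    _ = _ := one_mul _

theorem norm_liftMap_le_one (hv : ‖v‖ = 1) (hs : s * (1 + δ ^ 2) = 1)
    (hs1 : s ≤ 1) {x : F} (hx : ‖x‖ ≤ 1) : ‖liftMap v δ s x‖ ≤ 1 := by
  have h0 : liftMap v δ s 0 = 0 := by simp [liftMap]
  have := (lipschitzOnWith_liftMap hv hs hs1).dist_le_mul x
    (mem_closedBall_zero_iff.2 hx) 0 (mem_closedBall_self zero_le_one)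
  rw [h0, dist_zero_right, dist_zero_right, NNReal.coe_one, one_mul] at this
  exact this.trans hx

theorem mul_norm_le_norm_liftMap_sub (hv : ‖v‖ = 1) (hs0 : 0 < s) {κ : ℝ} {x y : F}
    (h : |⟪v, x - y⟫| ≤ κ * ‖x - y‖) :
    s ^ 2 * (1 - κ ^ 2) * ‖x - y‖ ^ 2 ≤ ‖liftMap v δ s x - liftMap v δ s y‖ ^ 2 := by
  rw [norm_liftMap_sub_sq hv, norm_projAlong_sq hv (x - y)]
  have h1 : ⟪v, x - y⟫ ^ 2 ≤ (κ * ‖x - y‖) ^ 2 := by rw [← sq_abs]; gcongr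
  rw [mul_assoc]
  gcongr
  have := sq_nonneg (δ / 2 * (‖projAlong v x‖ ^ 2 - ‖projAlong v y‖ ^ 2))
  nlinarith

theorem norm_liftMapDeriv_le (hv : ‖v‖ = 1) (hs : s * (1 + δ ^ 2) = 1) (hs0 : 0 < s)
    (hs1 : s ≤ 1) {x : F} (hx : ‖x‖ ≤ 1) (w : F) : ‖liftMapDeriv v δ s x w‖ ≤ ‖w‖ := by
  refine le_of_sq_le_sq ?_ (norm_nonneg _)
  have e : liftMapDeriv v δ s x w =
      s • (projAlong v w + (δ * ⟪projAlong v x, projAlong v w⟫) • v) := rfl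
  rw [e, norm_smul, mul_pow, Real.norm_eq_abs, sq_abs, norm_projAlong_add_smul_sq hv]
  have h1 : ⟪projAlong v x, projAlong v w⟫ ^ 2 ≤ ‖w‖ ^ 2 := by
    rw [← sq_abs]
    gcongr
    refine (abs_real_inner_le_norm _ _).trans ?_
    calc ‖projAlong v x‖ * ‖projAlong v w‖ ≤ 1 * ‖w‖ := by
          gcongr
          · exact (norm_projAlong_le hv x).trans hx
          · exact norm_projAlong_le hv w
      _ = _ := one_mul _
  have h2 := norm_projAlong_le hv w
  calc s ^ 2 * (‖projAlong v w‖ ^ 2 + (δ * ⟪projAlong v x, projAlong v w⟫) ^ 2)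
      ≤ s ^ 2 * (‖w‖ ^ 2 + δ ^ 2 * ‖w‖ ^ 2) := by rw [mul_pow]; gcongr
    _ = s * (s * (1 + δ ^ 2)) * ‖w‖ ^ 2 := by ring
    _ = s * ‖w‖ ^ 2 := by rw [hs, mul_one]
    _ ≤ 1 * ‖w‖ ^ 2 := by gcongr
    _ = _ := one_mul _

/-- The map is quadratic, so its second-order Taylor expansion is exact. -/
theorem liftMap_sub_eq_deriv_add (x y : F) : liftMap v δ s y - liftMap v δ s x =
    liftMapDeriv v δ s x (y - x) + (s * (δ / 2) * ‖projAlong v (y - x)‖ ^ 2) • v := by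
  have e : liftMapDeriv v δ s x (y - x) = s • (projAlong v (y - x) +
      (δ * ⟪projAlong v x, projAlong v (y - x)⟫) • v) := rfl
  have h : ‖projAlong v y‖ ^ 2 - ‖projAlong v x‖ ^ 2 =
      2 * ⟪projAlong v x, projAlong v (y - x)⟫ + ‖projAlong v (y - x)‖ ^ 2 := by
    have : projAlong v y = projAlong v x + projAlong v (y - x) := by rw [map_sub]; abel
    rw [this, norm_add_sq_real]; ring
  rw [liftMap_sub_liftMap, e, h, mul_assoc s, mul_smul s, ← smul_add, add_assoc, ← add_smul]
  congr 3
  ring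

theorem norm_sub_liftMap_le (hv : ‖v‖ = 1) (hδ : 0 ≤ δ) (hs : s * (1 + δ ^ 2) = 1) (hs0 : 0 < s)
    (hs1 : s ≤ 1) {x : F} (hx : ‖x‖ ≤ 1) :
    ‖x - liftMap v δ s x‖ ≤ |⟪v, x⟫| + δ ^ 2 + δ / 2 := by
  have hQ := (norm_projAlong_le hv x).trans hx
  have e : x - liftMap v δ s x = ⟪v, x⟫ • v + (1 - s) • projAlong v x -
      (s * (δ / 2 * ‖projAlong v x‖ ^ 2)) • v := by
    have : x = ⟪v, x⟫ • v + projAlong v x := by rw [projAlong_apply]; abel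
    calc x - liftMap v δ s x = ⟪v, x⟫ • v + projAlong v x - liftMap v δ s x := by rw [← this]
      _ = _ := by
        simp only [liftMap, smul_add, sub_smul, one_smul, smul_smul]
        abel
  rw [e]
  refine (norm_sub_le _ _).trans (add_le_add ((norm_add_le _ _).trans (add_le_add ?_ ?_)) ?_)
  · rw [norm_smul, hv, mul_one, Real.norm_eq_abs]
  · rw [norm_smul, Real.norm_eq_abs, abs_of_nonneg (by linarith)]
    have : 1 - s = s * δ ^ 2 := by linarith
    rw [this]
    calc s * δ ^ 2 * ‖projAlong v x‖ ≤ 1 * δ ^ 2 * 1 := by gcongr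
      _ = _ := by ring
  · rw [norm_smul, hv, mul_one, Real.norm_eq_abs, abs_of_nonneg (by positivity)]
    calc s * (δ / 2 * ‖projAlong v x‖ ^ 2) ≤ 1 * (δ / 2 * 1 ^ 2) := by gcongr
      _ = _ := by ring

end

theorem isBallExposed_image_liftMap {n : ℕ} {M : Set (EuclideanSpace ℝ (Fin n))}
    {v : EuclideanSpace ℝ (Fin n)} {δ s R : ℝ} (hv : ‖v‖ = 1) (hδ : 0 < δ)
    (hs : s * (1 + δ ^ 2) = 1) (hs0 : 0 < s) (hb : M ⊆ closedBall 0 1) (hR : 0 < R)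
    (hRδ : 1 + δ ^ 2 ≤ (R * δ) ^ 2) : IsBallExposed R (liftMap v δ s '' M) := by
  rintro _ ⟨p, hp, rfl⟩
  -- This is the inward normal of the paraboloid at the lifted point, and the centre of the ball
  -- lies along it. Containment reduces to `‖m‖ ≤ Rδ`.
  set m := v - δ • projAlong v p with hm
  have hp1 := mem_closedBall_zero_iff.1 (hb hp)
  have hmn : ‖m‖ ^ 2 = 1 + δ ^ 2 * ‖projAlong v p‖ ^ 2 := by
    rw [hm, norm_sub_sq_real, real_inner_smul_right, inner_projAlong hv, norm_smul, hv, mul_pow,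
      Real.norm_eq_abs, sq_abs]
    ring
  have hm0 : 0 < ‖m‖ := by
    rw [norm_pos_iff]; rintro h
    rw [h, norm_zero] at hmn
    nlinarith [sq_nonneg (δ * ‖projAlong v p‖)]
  have hmR : ‖m‖ ≤ R * δ := by
    refine le_of_sq_le_sq ?_ (by positivity)
    rw [hmn]
    refine le_trans ?_ hRδ
    have := (norm_projAlong_le hv p).trans hp1
    have h2 : ‖projAlong v p‖ ^ 2 ≤ 1 := by nlinarith [norm_nonneg (projAlong v p)]
    nlinarith [sq_nonneg δ]
  have hk : ‖(R / ‖m‖) • m‖ = R := by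
    rw [norm_smul, Real.norm_eq_abs, abs_of_pos (by positivity), div_mul_cancel₀ _ hm0.ne']
  refine ⟨liftMap v δ s p + (R / ‖m‖) • m, ?_, ?_⟩
  · rintro _ ⟨q, hq, rfl⟩
    rw [mem_closedBall, dist_eq_norm]
    refine le_of_sq_le_sq ?_ hR.le
    have e1 : liftMap v δ s q - (liftMap v δ s p + (R / ‖m‖) • m) =
        (liftMap v δ s q - liftMap v δ s p) - (R / ‖m‖) • m := by abel
    have e2 : ⟪liftMap v δ s q - liftMap v δ s p, m⟫ =
        s * δ / 2 * ‖projAlong v (q - p)‖ ^ 2 := by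
      have h0 : ⟪projAlong v (q - p), v⟫ = 0 := by rw [real_inner_comm, inner_projAlong hv]
      have h1 : ‖projAlong v q‖ ^ 2 = ‖projAlong v p‖ ^ 2 +
          2 * ⟪projAlong v (q - p), projAlong v p⟫ + ‖projAlong v (q - p)‖ ^ 2 := by
        have : projAlong v q = projAlong v p + projAlong v (q - p) := by rw [map_sub]; abel
        rw [this, norm_add_sq_real, real_inner_comm]
      rw [liftMap_sub_liftMap, hm, real_inner_smul_left, inner_add_left, inner_sub_right,
        inner_sub_right, h0, real_inner_smul_left, real_inner_smul_left, real_inner_smul_right,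
        real_inner_smul_right, inner_projAlong hv, real_inner_self_eq_norm_sq, hv, h1]
      ring
    rw [e1, norm_sub_sq_real, hk, real_inner_smul_right, e2]
    have h3 := norm_liftMap_sub_sq_le hv hs (mem_closedBall_zero_iff.1 (hb hq)) hp1
    have h4 : 1 ≤ R / ‖m‖ * δ := by
      rw [div_mul_eq_mul_div, le_div_iff₀ hm0]; linarith
    have h5 : 0 ≤ s * ‖projAlong v (q - p)‖ ^ 2 := by positivity
    have h6 := mul_le_mul_of_nonneg_right h4 h5
    nlinarith
  · rw [frontier_closedBall _ hR.ne', mem_sphere, dist_eq_norm, ← sub_sub, sub_self, zero_sub,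
      norm_neg, hk]

/-! ### Permanence of the manifold class under the lift -/

theorem norm_deriv_le_of_norm_sub_le {E F : Type*} [NormedAddCommGroup E] [NormedSpace ℝ E]
    [NormedAddCommGroup F] [NormedSpace ℝ F] {f : ℝ → E} {g : ℝ → F} {f' : E} {g' : F} {c t : ℝ}
    (hf : HasDerivAt f f' t) (hg : HasDerivAt g g' t)
    (h : ∀ᶠ u in 𝓝 t, c * ‖f u - f t‖ ≤ ‖g u - g t‖) : c * ‖f'‖ ≤ ‖g'‖ := by
  have h1 := (hasDerivAt_iff_tendsto_slope.1 hf).norm.const_mul c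
  have h2 := (hasDerivAt_iff_tendsto_slope.1 hg).norm
  refine le_of_tendsto_of_tendsto h1 h2 ?_
  filter_upwards [nhdsWithin_le_nhds h] with u hu
  rw [slope_def_module, slope_def_module, norm_smul, norm_smul]
  calc c * (‖(u - t)⁻¹‖ * ‖f u - f t‖) = ‖(u - t)⁻¹‖ * (c * ‖f u - f t‖) := by ring
    _ ≤ _ := by gcongr

theorem injective_of_le_norm_sub {E F : Type*} [NormedAddCommGroup E] [NormedAddCommGroup F]
    {M : Set E} {Φ : E → F} {c : ℝ} (hc : 0 < c)
    (h : ∀ x ∈ M, ∀ y ∈ M, c * ‖x - y‖ ≤ ‖Φ x - Φ y‖) : InjOn Φ M := by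
  intro x hx y hy he
  have := h x hx y hy
  rw [he, sub_self, norm_zero] at this
  have h2 : ‖x - y‖ ≤ 0 := by nlinarith
  exact sub_eq_zero.1 (norm_le_zero_iff.1 h2)

/-- The lower Lipschitz bound holds only on `M`, so immersivity comes from difference quotients
along curves in `M`; compactness turns injectivity into an embedding. -/
theorem IsC21Submanifold.image {d n : ℕ} {M : Set (EuclideanSpace ℝ (Fin n))}
    (hM : IsC21Submanifold d M) (hc : IsCompact M)
    {Φ : EuclideanSpace ℝ (Fin n) → EuclideanSpace ℝ (Fin n)} (hΦ : ContDiff ℝ 3 Φ)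
    {c : ℝ} (hc0 : 0 < c) (h : ∀ x ∈ M, ∀ y ∈ M, c * ‖x - y‖ ≤ ‖Φ x - Φ y‖) :
    IsC21Submanifold d (Φ '' M) := by
  have hinj := injective_of_le_norm_sub hc0 h
  rintro _ ⟨p, hp, rfl⟩
  obtain ⟨U, hU, hpU, W, φ, hW, hφ, hφinj, hemb, himg⟩ := hM p hp
  have hφM : ∀ x ∈ W, φ x ∈ M := fun x hx =>
    inter_subset_left (himg ▸ mem_image_of_mem φ hx : φ x ∈ M ∩ U)
  -- `Φ` need not be open, so the neighbourhood is obtained by removing the compact image of the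
  -- rest of `M`.
  refine ⟨(Φ '' (M \ U))ᶜ, ((hc.diff hU).image hΦ.continuous).isClosed.isOpen_compl, ?_, W,
    fun x => Φ (φ x), hW, hφ.contDiff_comp hW hΦ, ?_, ?_, ?_⟩
  · rintro ⟨q, ⟨hq, hqU⟩, he⟩
    exact hqU (hinj hq hp he ▸ hpU)
  · intro x hx
    have hd : HasFDerivAt φ (fderiv ℝ φ x) x :=
      ((hφ.1.differentiableOn (by norm_num)).differentiableAt (hW.mem_nhds hx)).hasFDerivAt
    have hD : HasFDerivAt (fun x => Φ (φ x)) ((fderiv ℝ Φ (φ x)).comp (fderiv ℝ φ x)) x :=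
      ((hΦ.differentiable (by norm_num)) (φ x)).hasFDerivAt.comp x hd
    rw [hD.fderiv]
    refine (injective_iff_map_eq_zero _).2 fun ξ hξ => ?_
    have hl : HasDerivAt (fun t : ℝ => x + t • ξ) ξ 0 := by
      simpa using ((hasDerivAt_id (0 : ℝ)).smul_const ξ).const_add x
    have h1 : HasDerivAt (fun t : ℝ => φ (x + t • ξ)) (fderiv ℝ φ x ξ) 0 :=
      HasFDerivAt.comp_hasDerivAt (f := fun t : ℝ => x + t • ξ) (0 : ℝ) (by simpa using hd) hl
    have h2 : HasDerivAt (fun t : ℝ => Φ (φ (x + t • ξ)))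
        ((fderiv ℝ Φ (φ x)).comp (fderiv ℝ φ x) ξ) 0 :=
      HasFDerivAt.comp_hasDerivAt (l := fun x => Φ (φ x)) (f := fun t : ℝ => x + t • ξ) (0 : ℝ)
        (by simpa using hD) hl
    have hev : ∀ᶠ t : ℝ in 𝓝 0, x + t • ξ ∈ W := by
      have : Continuous (fun t : ℝ => x + t • ξ) := by fun_prop
      exact this.continuousAt.eventually (by simpa using hW.mem_nhds hx)
    have h3 := norm_deriv_le_of_norm_sub_le h1 h2 (by
      filter_upwards [hev] with t ht
      exact h _ (hφM _ ht) _ (by simpa using hφM x hx))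
    rw [hξ, norm_zero] at h3
    have h4 : ‖fderiv ℝ φ x ξ‖ ≤ 0 := by nlinarith
    exact hφinj x hx (by rw [norm_le_zero_iff.1 h4, map_zero])
  · have : CompactSpace M := isCompact_iff_compactSpace.1 hc
    have e1 : IsEmbedding (fun x : M => Φ x) :=
      ((hΦ.continuous.comp continuous_subtype_val).isClosedEmbedding
        (fun x y he => Subtype.ext (hinj x.2 y.2 he))).isEmbedding
    exact e1.comp (hemb.codRestrict M fun x => hφM x x.2)
  · have : (fun x => Φ (φ x)) '' W = Φ '' (M ∩ U) := by rw [← himg, image_image]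
    rw [this]
    ext y
    constructor
    · rintro ⟨q, ⟨hq, hqU⟩, rfl⟩
      refine ⟨⟨q, hq, rfl⟩, ?_⟩
      rintro ⟨z, ⟨hz, hzU⟩, he⟩
      exact hzU (hinj hz hq he ▸ hqU)
    · rintro ⟨⟨q, hq, rfl⟩, hn⟩
      by_contra hcon
      exact hn ⟨q, ⟨hq, fun hqU => hcon ⟨q, ⟨hq, hqU⟩, rfl⟩⟩, rfl⟩

theorem IsBallExposed.subset_frontier_convexHull {n : ℕ} {M : Set (EuclideanSpace ℝ (Fin n))}
    {R : ℝ} (hR : 0 < R) (h : IsBallExposed R M) : M ⊆ frontier (convexHull ℝ M) := by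
  intro p hp
  obtain ⟨z, hz, hpz⟩ := h p hp
  refine ⟨subset_closure (subset_convexHull ℝ M hp), fun hint => ?_⟩
  rw [frontier_closedBall _ hR.ne'] at hpz
  have := interior_mono (convexHull_min hz (convex_closedBall z R)) hint
  rw [interior_closedBall _ hR.ne'] at this
  exact (mem_ball.1 this).ne hpz

theorem frontier_convexHull_subset_closedBall {F : Type*} [NormedAddCommGroup F]
    [NormedSpace ℝ F] {M : Set F} {x : F} {r : ℝ} (h : M ⊆ closedBall x r) :
    frontier (convexHull ℝ M) ⊆ closedBall x r :=
  frontier_subset_closure.trans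
    (closure_minimal (convexHull_min h (convex_closedBall x r)) isClosed_closedBall)

/-- The vector `x - liftMap v δ s p` is normal to the image, so only two terms of the lifted secant
count: the image of its normal part, controlled by `τ`, and the paraboloid's quadratic term,
controlled by `δ`. Dividing by the contracted squared length gives the condition on `τ₁`. -/
theorem HasTangentField.inner_liftMap_le {F : Type*} [NormedAddCommGroup F]
    [InnerProductSpace ℝ F] [FiniteDimensional ℝ F] {d : ℕ} {M : Set F} {τ : ℝ}
    {T : F → Submodule ℝ F} (h : HasTangentField d M τ T) (hb : M ⊆ closedBall 0 1)
    {v : F} {δ s κ τ₁ : ℝ} (hv : ‖v‖ = 1) (hδ : 0 ≤ δ) (hs : s * (1 + δ ^ 2) = 1) (hs0 : 0 < s)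
    (hs1 : s ≤ 1) (hκ : ∀ p ∈ M, ∀ q ∈ M, |⟪v, q - p⟫| ≤ κ * ‖q - p‖) (hτ₁ : 0 < τ₁)
    (hle : (1 + δ * τ) * τ₁ ≤ s ^ 2 * (1 - κ ^ 2) * τ) {p q x : F} (hp : p ∈ M) (hq : q ∈ M)
    (hx : ∀ z ∈ M, dist x (liftMap v δ s p) ≤ dist x (liftMap v δ s z)) :
    ⟪x - liftMap v δ s p, liftMap v δ s q - liftMap v δ s p⟫ ≤
      ‖x - liftMap v δ s p‖ * ‖liftMap v δ s q - liftMap v δ s p‖ ^ 2 / (2 * τ₁) := by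
  have hτ := h.pos
  set ν := x - liftMap v δ s p with hν
  have hp1 := mem_closedBall_zero_iff.1 (hb hp)
  have hT : ∀ a ∈ T p, ⟪ν, liftMapDeriv v δ s p a⟫ = 0 := by
    intro a ha
    have hd : HasFDerivAt (fun z => ‖x - liftMap v δ s z‖ ^ 2)
        (2 • (innerSL ℝ (x - liftMap v δ s p)).comp (-liftMapDeriv v δ s p)) p :=
      ((hasFDerivAt_liftMap p).const_sub x).norm_sq
    have hext : IsLocalExtrOn (fun z => ‖x - liftMap v δ s z‖ ^ 2) M p := by
      refine Or.inl (Filter.eventually_of_mem self_mem_nhdsWithin fun z hz => ?_)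
      have := hx z hz
      rw [dist_eq_norm, dist_eq_norm] at this
      show ‖x - liftMap v δ s p‖ ^ 2 ≤ ‖x - liftMap v δ s z‖ ^ 2
      gcongr
    have := (h.isTangent p hp).fderiv_eq_zero_of_isLocalExtrOn hd hext ha
    simp only [two_smul, add_apply, ContinuousLinearMap.comp_apply,
      neg_apply, innerSL_apply_apply, inner_neg_right] at this
    linarith
  obtain ⟨a, ha, w, hqp, -, hw⟩ := h.exists_decomposition hp hq
  have e1 : liftMap v δ s q - liftMap v δ s p = liftMapDeriv v δ s p a +
      (liftMapDeriv v δ s p w + (s * (δ / 2) * ‖projAlong v (q - p)‖ ^ 2) • v) := by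
    rw [liftMap_sub_eq_deriv_add, ← add_assoc, ← map_add, ← hqp]
  have e2 : ‖liftMapDeriv v δ s p w + (s * (δ / 2) * ‖projAlong v (q - p)‖ ^ 2) • v‖ ≤
      (1 + δ * τ) * ‖q - p‖ ^ 2 / (2 * τ) := by
    refine (norm_add_le _ _).trans ?_
    have f1 := (norm_liftMapDeriv_le hv hs hs0 hs1 hp1 w).trans hw
    have f2 : ‖(s * (δ / 2) * ‖projAlong v (q - p)‖ ^ 2) • v‖ ≤ δ / 2 * ‖q - p‖ ^ 2 := by
      rw [norm_smul, hv, mul_one, Real.norm_eq_abs, abs_of_nonneg (by positivity)]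
      have := norm_projAlong_le hv (q - p)
      calc s * (δ / 2) * ‖projAlong v (q - p)‖ ^ 2 ≤ 1 * (δ / 2) * ‖q - p‖ ^ 2 := by gcongr
        _ = _ := by ring
    refine (add_le_add f1 f2).trans (le_of_eq ?_)
    field_simp
  have e3 : s ^ 2 * (1 - κ ^ 2) * ‖q - p‖ ^ 2 ≤ ‖liftMap v δ s q - liftMap v δ s p‖ ^ 2 :=
    mul_norm_le_norm_liftMap_sub hv hs0 (hκ p hp q hq)
  have e4 : (1 + δ * τ) * ‖q - p‖ ^ 2 / (2 * τ) ≤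
      ‖liftMap v δ s q - liftMap v δ s p‖ ^ 2 / (2 * τ₁) := by
    rw [div_le_div_iff₀ (by positivity) (by positivity)]
    have g1 := mul_le_mul_of_nonneg_right hle (sq_nonneg ‖q - p‖)
    have g2 := mul_le_mul_of_nonneg_right e3 hτ.le
    nlinarith
  conv_lhs => rw [e1, inner_add_right, hT a ha, zero_add]
  refine (real_inner_le_norm _ _).trans ?_
  rw [mul_div_assoc]
  gcongr
  exact e2.trans e4

theorem ManifoldClass.image_liftMap {d n : ℕ} {V τ : ℝ} {M : Set (EuclideanSpace ℝ (Fin n))}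
    (h : ManifoldClass d n V τ M) {T : EuclideanSpace ℝ (Fin n) → Submodule ℝ _}
    (hT : HasTangentField d M τ T) (hb : M ⊆ closedBall 0 1)
    {v : EuclideanSpace ℝ (Fin n)} {δ s κ τ₁ R : ℝ} (hv : ‖v‖ = 1) (hδ : 0 < δ)
    (hs : s * (1 + δ ^ 2) = 1) (hs0 : 0 < s) (hs1 : s ≤ 1)
    (hκ : ∀ p ∈ M, ∀ q ∈ M, |⟪v, q - p⟫| ≤ κ * ‖q - p‖) (hκ1 : κ ^ 2 < 1) (hτ₁ : 0 < τ₁)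
    (hle : (1 + δ * τ) * τ₁ ≤ s ^ 2 * (1 - κ ^ 2) * τ) (hR : 0 < R)
    (hRδ : 1 + δ ^ 2 ≤ (R * δ) ^ 2) : ManifoldClass d n V τ₁ (liftMap v δ s '' M) := by
  have hc : IsCompact M := (isCompact_closedBall 0 1).of_isClosed_subset h.isClosed hb
  have hcl : IsClosed (liftMap v δ s '' M) := (hc.image contDiff_liftMap.continuous).isClosed
  have hk0 : 0 < s ^ 2 * (1 - κ ^ 2) := by have := sub_pos.2 hκ1; positivity
  refine ⟨hτ₁, h.nonempty.image _, hcl, ?_, ?_, ?_, ?_, ?_⟩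
  · refine h.submanifold.image hc contDiff_liftMap (Real.sqrt_pos.2 hk0) fun x hx y hy => ?_
    refine le_of_sq_le_sq ?_ (norm_nonneg _)
    rw [mul_pow, Real.sq_sqrt hk0.le]
    exact mul_norm_le_norm_liftMap_sub hv hs0 (hκ y hy x hx)
  · exact (isBallExposed_image_liftMap hv hδ hs hs0 hb hR hRδ).subset_frontier_convexHull hR
  · refine frontier_convexHull_subset_closedBall ?_
    rintro _ ⟨x, hx, rfl⟩
    exact mem_closedBall_zero_iff.2
      (norm_liftMap_le_one hv hs hs1 (mem_closedBall_zero_iff.1 (hb hx)))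
  · exact (((lipschitzOnWith_liftMap hv hs hs1).mono hb).euclideanHausdorffMeasure_image_le
      d).trans h.volume_le
  · refine ofReal_le_reach fun r hr0 hr => HasUniqueProj.of_inner_le hcl (h.nonempty.image _) hr0
      hr ?_
    rintro _ ⟨p, hp, rfl⟩ x hx _ ⟨q, hq, rfl⟩
    exact hT.inner_liftMap_le hb hv hδ.le hs hs0 hs1 hκ hτ₁ hle hp hq
      fun z hz => hx _ (mem_image_of_mem _ hz)

/-! ### Choice of parameters and conclusion -/

theorem ManifoldClass.dim_pos {d n : ℕ} {V τ : ℝ} {M : Set (EuclideanSpace ℝ (Fin n))}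
    (h : ManifoldClass d n V τ M) : 0 < n := by
  by_contra hn
  obtain rfl : n = 0 := by omega
  obtain ⟨p, hp⟩ := h.nonempty
  have := h.subset_frontier hp
  have hu : convexHull ℝ M = univ :=
    h.nonempty.convexHull.eq_univ
  rw [hu, frontier_univ] at this
  exact this

theorem ManifoldClass.subset_closedBall {d n : ℕ} {V τ : ℝ} {M : Set (EuclideanSpace ℝ (Fin n))}
    (h : ManifoldClass d n V τ M) : M ⊆ closedBall 0 1 :=
  h.subset_frontier.trans h.frontier_subset

theorem Set.Subsingleton.isBallExposed {n : ℕ} (hn : 0 < n) {M : Set (EuclideanSpace ℝ (Fin n))}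
    (hM : M.Subsingleton) {R : ℝ} (hR : 0 < R) : IsBallExposed R M := by
  have : Nonempty (Fin n) := ⟨⟨0, hn⟩⟩
  intro p hp
  obtain ⟨e, he⟩ := exists_norm_eq (EuclideanSpace ℝ (Fin n)) hR.le
  have hd : dist p (p + e) = R := by rw [dist_eq_norm, ← sub_sub, sub_self, zero_sub, norm_neg, he]
  refine ⟨p + e, fun q hq => ?_, ?_⟩
  · rw [hM hq hp]; exact hd.le
  · rw [frontier_closedBall _ hR.ne']; exact hd

/-- For `d = 0` the quotient `τ / (2 * d)` is `0` by convention, so the minimum is not a usable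
radius and `ετ/2` replaces it; the powers still agree. -/
theorem exists_radius (d : ℕ) {τ ε : ℝ} (hτ : 0 < τ) (hε : 0 < ε) :
    ∃ r, 0 < r ∧ 2 * r ≤ ε * τ ∧ 2 * d * r ≤ τ ∧
      r ^ d = (min (τ / (2 * d)) (ε * τ / 2)) ^ d := by
  rcases Nat.eq_zero_or_pos d with rfl | hd
  · exact ⟨ε * τ / 2, by positivity, by linarith, by simpa using hτ.le, by simp⟩
  · have hd' : (0 : ℝ) < d := by exact_mod_cast hd
    refine ⟨_, lt_min (by positivity) (by positivity), ?_, ?_, rfl⟩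
    · linarith [min_le_right (τ / (2 * d)) (ε * τ / 2)]
    · have := min_le_left (τ / (2 * d)) (ε * τ / 2)
      rw [le_div_iff₀ (by positivity)] at this
      linarith

theorem mainTheorem6 :
    ∃ c C : ℝ, 0 < c ∧ 0 < C ∧
      ∀ (d n : ℕ) (V τ ε : ℝ) (M : Set (EuclideanSpace ℝ (Fin n))),
        0 < ε → ε < c → ManifoldClass d n V τ M →
        C * V / unitBallVolume d * ((min (τ / (2 * d)) (ε * τ / 2)) ^ d)⁻¹ < (n : ℝ) →
        ∃ M₁ : Set (EuclideanSpace ℝ (Fin n)),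
          ManifoldClass d n V (τ * (1 - C * ε)) M₁ ∧
          Metric.hausdorffDist M M₁ < ε * τ ∧
          IsBallExposed ((ε * τ)⁻¹) M₁ := by
  refine ⟨1 / 400, 60, by norm_num, by norm_num, fun d n V τ ε M hε hεc hM hn => ?_⟩
  have hτ := hM.tau_pos
  have hb := hM.subset_closedBall
  have hετ : 0 < ε * τ := by positivity
  have hτ₁ : 0 < τ * (1 - 60 * ε) := mul_pos hτ (by linarith)
  have hn0 := hM.dim_pos
  obtain ⟨T, hT⟩ := hM.exists_hasTangentField
  rcases hT.subsingleton_or_le_one hb hM.nonempty with hsub | hτ1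
  -- A single point is already exposed and needs no change. It is treated apart because its reach is
  -- infinite, so `τ` need not be at most `1`.
  · refine ⟨M, ⟨hτ₁, hM.nonempty, hM.isClosed, hM.submanifold, hM.subset_frontier,
      hM.frontier_subset, hM.volume_le, le_trans ?_ hM.reach_ge⟩, by simpa using hετ,
      hsub.isBallExposed hn0 (inv_pos.2 hετ)⟩
    exact ENNReal.ofReal_le_ofReal (by nlinarith)
  obtain ⟨r, hr0, hr2, hdr, hrd⟩ := exists_radius d hτ hε
  rw [← hrd] at hn
  have hω : 0 ≤ unitBallVolume d := measureReal_nonneg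
  obtain ⟨v, hv, hnet⟩ := hT.exists_unit_orthogonal_net hM.volume_le (r := r) (by nlinarith) hr0
    hdr (by simpa using hn0) (by
      rw [finrank_euclideanSpace, Fintype.card_fin]
      rcases le_total 0 V with hV | hV
      · refine lt_of_le_of_lt ?_ hn
        have e : V / (r ^ d / 2 * unitBallVolume d) =
            2 * V / unitBallVolume d * (r ^ d)⁻¹ := by
          rw [div_mul_eq_mul_div, div_div_eq_mul_div, ← div_eq_mul_inv, div_div]
          ring
        rw [e]
        gcongr
        norm_num
      · exact (div_nonpos_of_nonpos_of_nonneg hV (by positivity)).trans_lt (by exact_mod_cast hn0))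
  set σ := √ε with hσ_def
  have hσ : 0 < σ := Real.sqrt_pos.2 hε
  have hσ2 : σ ^ 2 = ε := Real.sq_sqrt hε.le
  have hσ20 : σ < 1 / 20 := by
    rw [hσ_def, Real.sqrt_lt' (by norm_num)]; linarith
  have hbound : ∀ x ∈ M, |⟪v, x⟫| ≤ σ ^ 2 * τ := by
    intro x hx
    obtain ⟨p, -, hxp, hp0⟩ := hnet x hx
    have e : ⟪v, x⟫ = ⟪v, x - p⟫ := by rw [inner_sub_right, hp0, sub_zero]
    rw [e, hσ2]
    refine (abs_real_inner_le_norm _ _).trans ?_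
    rw [hv, one_mul]; linarith
  have hκ : ∀ p ∈ M, ∀ q ∈ M, |⟪v, q - p⟫| ≤ 13 / 2 * σ * ‖q - p‖ := fun p hp q hq =>
    hT.abs_inner_sub_le hv hσ hbound hp hq
  have hκ2 : (13 / 2 * σ) ^ 2 = 169 / 4 * ε := by rw [mul_pow, hσ2]; norm_num
  -- The height bound `ετ` would use up the whole Hausdorff budget; applying the slope estimate to
  -- the step from the net point improves it.
  have hsmall : ∀ x ∈ M, |⟪v, x⟫| ≤ 13 / 40 * (ε * τ) := by
    intro x hx
    obtain ⟨p, hp, hxp, hp0⟩ := hnet x hx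
    have e : ⟪v, x⟫ = ⟪v, x - p⟫ := by rw [inner_sub_right, hp0, sub_zero]
    rw [e]
    refine (hκ p hp x hx).trans ?_
    calc 13 / 2 * σ * ‖x - p‖ ≤ 13 / 2 * (1 / 20) * (ε * τ) := by gcongr; linarith
      _ = _ := by ring
  -- Exposedness needs `Rδ` slightly above `1`, while the displacement `13/40 + 1/100 + 3/5`, in
  -- units of `ετ`, must stay below `1`.
  set δ := 6 / 5 * (ε * τ) with hδ_def
  have hδ : 0 < δ := by positivity
  have hετε : ε * τ ≤ ε := mul_le_of_le_one_right hε.le hτ1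
  have hδε : δ ≤ 6 / 5 * ε := by rw [hδ_def]; linarith
  have hδ2 : δ ^ 2 ≤ ε / 100 := by nlinarith
  set s := (1 + δ ^ 2)⁻¹ with hs_def
  have hs : s * (1 + δ ^ 2) = 1 := inv_mul_cancel₀ (by positivity)
  have hs0 : 0 < s := by positivity
  have hs1 : s ≤ 1 := inv_le_one_of_one_le₀ (by linarith [sq_nonneg δ])
  have hR : 0 < (ε * τ)⁻¹ := inv_pos.2 hετ
  have hRδ : 1 + δ ^ 2 ≤ ((ε * τ)⁻¹ * δ) ^ 2 := by
    have : (ε * τ)⁻¹ * δ = 6 / 5 := by rw [hδ_def]; field_simp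
    rw [this]; linarith
  -- To first order in `ε` the losses are at most `6/5` from the curvature, `1` from the scaling and
  -- `169/4` from the slope, together well below `60`.
  have hle : (1 + δ * τ) * (τ * (1 - 60 * ε)) ≤ s ^ 2 * (1 - (13 / 2 * σ) ^ 2) * τ := by
    rw [hκ2]
    have a1 : 1 - ε / 100 ≤ s := by nlinarith
    have a2 : (1 - ε / 100) ^ 2 ≤ s ^ 2 := by gcongr; linarith
    have a3 : 1 - ε ≤ s ^ 2 := by nlinarith
    have a4 : δ * τ ≤ 6 / 5 * ε := (mul_le_of_le_one_right hδ.le hτ1).trans hδε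
    have a5 : (1 + δ * τ) * (1 - 60 * ε) ≤ (1 + 6 / 5 * ε) * (1 - 60 * ε) := by
      gcongr; linarith
    have a6 : (1 - ε) * (1 - 169 / 4 * ε) ≤ s ^ 2 * (1 - 169 / 4 * ε) := by
      gcongr; linarith
    have a7 : (1 + δ * τ) * (1 - 60 * ε) ≤ s ^ 2 * (1 - 169 / 4 * ε) := by nlinarith
    have := mul_le_mul_of_nonneg_right a7 hτ.le
    linarith
  refine ⟨liftMap v δ s '' M, hM.image_liftMap hT hb hv hδ hs hs0 hs1 hκ (by rw [hκ2]; linarith)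
    hτ₁ hle hR hRδ, ?_, isBallExposed_image_liftMap hv hδ hs hs0 hb hR hRδ⟩
  have hδ2' : δ ^ 2 ≤ 1 / 100 * (ε * τ) := by
    have : δ ^ 2 = 36 / 25 * (ε * τ) * (ε * τ) := by rw [hδ_def]; ring
    rw [this]
    calc 36 / 25 * (ε * τ) * (ε * τ) ≤ 36 / 25 * (1 / 400) * (ε * τ) := by gcongr; linarith
      _ ≤ _ := by gcongr; norm_num
  have hdist : ∀ x ∈ M, dist x (liftMap v δ s x) ≤ 19 / 20 * (ε * τ) := by
    intro x hx
    rw [dist_eq_norm]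
    refine (norm_sub_liftMap_le hv hδ.le hs hs0 hs1 (mem_closedBall_zero_iff.1 (hb hx))).trans ?_
    have := hsmall x hx
    linarith
  refine lt_of_le_of_lt (hausdorffDist_le_of_mem_dist (r := 19 / 20 * (ε * τ)) (by positivity)
    (fun x hx => ⟨_, mem_image_of_mem _ hx, hdist x hx⟩) ?_) (by linarith)
  rintro _ ⟨x, hx, rfl⟩
  exact ⟨x, hx, by rw [dist_comm]; exact hdist x hx⟩
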